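/- Let $D\ge 1$ and $\ell\ge 2$ be integers and let $\mathcal F_n$ be the family of $\ell$-adic cubes $\prod_{i=1}^D[k_i\ell^{-n},(k_i+1)\ell^{-n})$, $0\le k_i<\ell^n$, of $[0,1)^D$. Suppose that the cubes of $\mathcal F_n$ are coded bijectively as $I_{\varepsilon_1\cdots\varepsilon_n}$, $0\le\varepsilon_i<\ell^D$, for every $n\ge 0$, in such a way that $I_{\varepsilon_1\cdots\varepsilon_{n+1}}\subset I_{\varepsilon_1\cdots\varepsilon_n}$, and for $I=I_{\varepsilon_1\cdots\varepsilon_n}$, $J=I_{\varepsilon_{n+1}\cdots\varepsilon_{n+p}}$ write $IJ=I_{\varepsilon_1\cdots\varepsilon_{n+p}}$. Let $m$ be a quasi-Bernoulli measure, that is, a Borel probability measure on $[0,1)^D$ for which there is a constant $C\ge 1$ with $$\frac1C\,m(I)m(J)\le m(IJ)\le C\,m(I)m(J)\qquad\text{for all } I,J\in\bigcup_n\mathcal F_n .$$ Let $$\tau(q)=\limsup_{n\to\infty}\frac1{n\log\ell}\log\Big(\sum_{I\in\mathcal F_n,\ m(I)>0}m(I)^q\Big),\qquad d=-\tau'(1),\qquad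 \chi(q)=\tau(1-q)-qd,$$ and let $S_n(x)=-\sum_{k=1}^n\log_\ell\frac{m(I_k(x))}{m(I_{k-1}(x))}$, where $I_k(x)$ is the cube of $\mathcal F_k$ containing $x$. Suppose that there is a constant $C>0$ such that $$\forall q\in(0,1],\qquad 0<\chi(q)\le C\,\chi(q/2).$$ Then $\chi$ is a bijection of $[0,1]$ onto $[0,\chi(1)]$; write $\chi^{-1}$ for its inverse and $\theta(t)=1/\chi^{-1}(1/t)$ for $t\ge 1/\chi(1)$. For $m$-almost every $x$, $$\limsup_{n\to\infty}\frac{S_n(x)-nd}{\theta(n)}\ge 1 .$$ As a consequence, for every $0<a<1$, $$m\ll\widehat{\mathcal P}^{\psi_a},\qquad \psi_a(t)=t^d\,\ell^{-a\,\theta(\log_\ell(1/t))}\quad(t>0\text{ small}),$$ and in particular $m\ll\widehat{\mathcal P}^d$, the packing measure for the gauge $t^d$. Here, for a gauge $\psi$, $\widehat{\mathcal P}^\psi(E)=\inf\{\sum_i\mathcal P^\psi(E_i): E\subset\bigcup_{i\in\mathbb N}E_i\}$ is the packing measure on $\mathbb R^D$, where $\mathcal P^\psi(E)=\lim_{\delta\to0}\sup\sum_i\psi(2r_i)$,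 the supremum being over countable families of pairwise disjoint closed Euclidean balls with centres in $E$ and radii $0<r_i\le\delta$. -/

import Mathlib

open MeasureTheory Filter Set
open scoped ENNReal

noncomputable section

namespace QuasiBernoulli

/-! ### Packing measures -/

section Packing

variable {X : Type*} [MetricSpace X]

/-- A `δ`-packing of `E`: a countable family of pairwise disjoint closed balls, coded by
(centre, radius), with centres in `E` and radii in `(0, δ]`. -/
structure IsPacking (δ : ℝ) (E : Set X) (S : Set (X × ℝ)) : Prop where
  countable : S.Countable
  center_mem : ∀ p ∈ S, p.1 ∈ E
  radius_pos : ∀ p ∈ S, 0 < p.2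
  radius_le : ∀ p ∈ S, p.2 ≤ δ
  disjoint : S.PairwiseDisjoint fun p => Metric.closedBall p.1 p.2

/-- `P^ψ_δ(E) = sup ∑ ψ(2 rᵢ)` over all `δ`-packings of `E`; in `ℝ^D`, `D ≥ 1`, the number `2 rᵢ`
is the diameter of the ball. -/
def packingPreAt (ψ : ℝ → ℝ≥0∞) (δ : ℝ) (E : Set X) : ℝ≥0∞ :=
  ⨆ (S : Set (X × ℝ)) (_ : IsPacking δ E S), ∑' p : S, ψ (2 * (p : X × ℝ).2)

/-- The packing pre-measure `P^ψ(E) = lim_{δ → 0} P^ψ_δ(E)` (an infimum, by monotonicity). -/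
def packingPre (ψ : ℝ → ℝ≥0∞) (E : Set X) : ℝ≥0∞ :=
  ⨅ (δ : ℝ) (_ : 0 < δ), packingPreAt ψ δ E

theorem IsPacking.mono {δ δ' : ℝ} {E F : Set X} {S : Set (X × ℝ)} (h : IsPacking δ E S)
    (hδ : δ ≤ δ') (hE : E ⊆ F) : IsPacking δ' F S :=
  ⟨h.countable, fun p hp => hE (h.center_mem p hp), h.radius_pos,
    fun p hp => (h.radius_le p hp).trans hδ, h.disjoint⟩

theorem packingPreAt_mono (ψ : ℝ → ℝ≥0∞) {δ δ' : ℝ} {E F : Set X} (hδ : δ ≤ δ') (hE : E ⊆ F) :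
    packingPreAt ψ δ E ≤ packingPreAt ψ δ' F :=
  iSup₂_le fun S hS => le_iSup₂_of_le S (hS.mono hδ hE) le_rfl

theorem packingPre_mono (ψ : ℝ → ℝ≥0∞) {E F : Set X} (hE : E ⊆ F) :
    packingPre ψ E ≤ packingPre ψ F :=
  iInf₂_mono fun _ _ => packingPreAt_mono ψ le_rfl hE

theorem packingPre_empty (ψ : ℝ → ℝ≥0∞) : packingPre ψ (∅ : Set X) = 0 := by
  refine le_antisymm (iInf₂_le_of_le 1 one_pos (iSup₂_le fun S hS => ?_)) (zero_le)
  have : S = ∅ := eq_empty_of_forall_notMem fun p hp => hS.center_mem p hp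
  subst this
  simp

/-- The packing outer measure `P̂^ψ(E) = inf {∑ P^ψ(Eᵢ) : E ⊆ ⋃ Eᵢ}` (countable covers). -/
def packingOuter (ψ : ℝ → ℝ≥0∞) : OuterMeasure X :=
  OuterMeasure.ofFunction (packingPre ψ) (packingPre_empty ψ)

theorem packingPre_add_le (ψ : ℝ → ℝ≥0∞) {s t : Set X} (h : Metric.AreSeparated s t) :
    packingPre ψ s + packingPre ψ t ≤ packingPre ψ (s ∪ t) := by
  obtain ⟨r, hr0, hr⟩ := h
  obtain ⟨η, hη, hηr⟩ : ∃ η : ℝ, 0 < η ∧ ENNReal.ofReal (η + η) < r := by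
    obtain ⟨c, hc0, hcr⟩ := exists_between (pos_iff_ne_zero.2 hr0)
    have hct : c ≠ ∞ := hcr.ne_top
    have := ENNReal.toReal_pos hc0.ne' hct
    refine ⟨c.toReal / 2, by positivity, ?_⟩
    rwa [add_halves, ENNReal.ofReal_toReal hct]
  refine le_iInf₂ fun δ hδ => ?_
  have key : packingPreAt ψ (min δ η) s + packingPreAt ψ (min δ η) t
      ≤ packingPreAt ψ δ (s ∪ t) := by
    refine ENNReal.biSup_add_biSup_le' (p := IsPacking (min δ η) s)
      (q := IsPacking (min δ η) t) ⟨∅, by constructor <;> simp⟩ ⟨∅, by constructor <;> simp⟩ ?_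
    intro S hS T hT
    have hfar : ∀ p ∈ S, ∀ q ∈ T,
        Disjoint (Metric.closedBall p.1 p.2) (Metric.closedBall q.1 q.2) := by
      intro p hp q hq
      refine Metric.closedBall_disjoint_closedBall ?_
      by_contra! hle
      have h1 := hr p.1 (hS.center_mem p hp) q.1 (hT.center_mem q hq)
      rw [edist_dist] at h1
      have h2 : dist p.1 q.1 ≤ η + η :=
        hle.trans (add_le_add ((hS.radius_le p hp).trans (min_le_right _ _))
          ((hT.radius_le q hq).trans (min_le_right _ _)))
      exact absurd (h1.trans (ENNReal.ofReal_le_ofReal h2)) (not_le.2 hηr)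
    have hST : Disjoint S T := by
      refine Set.disjoint_left.2 fun p hp hq => ?_
      have := hfar p hp p hq
      rw [disjoint_self] at this
      have hmem := Metric.mem_closedBall_self (x := p.1) (hS.radius_pos p hp).le
      rw [this] at hmem
      exact hmem
    have hU : IsPacking δ (s ∪ t) (S ∪ T) := by
      refine ⟨hS.countable.union hT.countable, ?_, ?_, ?_, ?_⟩
      · rintro p (hp | hp)
        · exact Or.inl (hS.center_mem p hp)
        · exact Or.inr (hT.center_mem p hp)
      · rintro p (hp | hp)
        · exact hS.radius_pos p hp
        · exact hT.radius_pos p hp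
      · rintro p (hp | hp)
        · exact (hS.radius_le p hp).trans (min_le_left _ _)
        · exact (hT.radius_le p hp).trans (min_le_left _ _)
      · rintro p (hp | hp) q (hq | hq) hne
        · exact hS.disjoint hp hq hne
        · exact hfar p hp q hq
        · exact (hfar q hq p hp).symm
        · exact hT.disjoint hp hq hne
    refine le_iSup₂_of_le (S ∪ T) hU (le_of_eq ?_)
    exact (ENNReal.summable.tsum_union_disjoint (f := fun p : X × ℝ => ψ (2 * p.2)) hST
      ENNReal.summable).symm
  have hm : 0 < min δ η := lt_min hδ hη
  exact (add_le_add (iInf₂_le _ hm) (iInf₂_le _ hm)).trans key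

theorem packingOuter_isMetric (ψ : ℝ → ℝ≥0∞) : (packingOuter ψ : OuterMeasure X).IsMetric := by
  intro s t hst
  refine le_antisymm (measure_union_le s t) ?_
  conv_rhs => rw [packingOuter, OuterMeasure.ofFunction_apply]
  refine le_iInf₂ fun U hU => ?_
  have hs : packingOuter ψ s ≤ ∑' i, packingPre ψ (U i ∩ s) := by
    rw [packingOuter, OuterMeasure.ofFunction_apply]
    refine iInf₂_le (fun i => U i ∩ s) fun x hx => ?_
    obtain ⟨i, hi⟩ := mem_iUnion.1 (hU (Or.inl hx))
    exact mem_iUnion.2 ⟨i, hi, hx⟩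
  have ht : packingOuter ψ t ≤ ∑' i, packingPre ψ (U i ∩ t) := by
    rw [packingOuter, OuterMeasure.ofFunction_apply]
    refine iInf₂_le (fun i => U i ∩ t) fun x hx => ?_
    obtain ⟨i, hi⟩ := mem_iUnion.1 (hU (Or.inr hx))
    exact mem_iUnion.2 ⟨i, hi, hx⟩
  refine (add_le_add hs ht).trans ?_
  rw [← ENNReal.tsum_add]
  refine ENNReal.tsum_le_tsum fun i => ?_
  have hsep : Metric.AreSeparated (U i ∩ s) (U i ∩ t) :=
    hst.mono inter_subset_right inter_subset_right
  exact (packingPre_add_le ψ hsep).trans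
    (packingPre_mono ψ (union_subset inter_subset_left inter_subset_left))

/-- The packing measure `P̂^ψ`, as a Borel measure. -/
def packingMeasure [MeasurableSpace X] [BorelSpace X] (ψ : ℝ → ℝ≥0∞) : Measure X :=
  (packingOuter ψ).toMeasure <| by
    rw [BorelSpace.measurable_eq (α := X)]
    exact (packingOuter_isMetric ψ).borel_le_caratheodory

end Packing

/-! ### `ℓ`-adic cubes, quasi-Bernoulli measures, the `L^q`-spectrum -/

/-- The unit cube `[0,1)^D`. -/
def unitCube (D : ℕ) : Set (EuclideanSpace ℝ (Fin D)) := {x | ∀ i, x i ∈ Ico (0 : ℝ) 1}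

/-- The cube `∏ [k_i / ℓ^n, (k_i + 1) / ℓ^n)`. -/
def adicCube (ℓ D n : ℕ) (k : Fin D → ℕ) : Set (EuclideanSpace ℝ (Fin D)) :=
  {x | ∀ i, x i ∈ Ico ((k i : ℝ) / (ℓ : ℝ) ^ n) (((k i : ℝ) + 1) / (ℓ : ℝ) ^ n)}

/-- The family `𝓕_n` of `ℓ`-adic cubes of generation `n` in `[0,1)^D`. -/
def adicCubes (ℓ D n : ℕ) : Set (Set (EuclideanSpace ℝ (Fin D))) :=
  {Q | ∃ k : Fin D → ℕ, (∀ i, k i < ℓ ^ n) ∧ Q = adicCube ℓ D n k}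

/-- `I_n(x)`: for `x ∈ [0,1)^D`, the unique cube of `𝓕_n` that contains `x`. -/
def cubeAt (ℓ D n : ℕ) (x : EuclideanSpace ℝ (Fin D)) : Set (EuclideanSpace ℝ (Fin D)) :=
  adicCube ℓ D n fun i => ⌊(ℓ : ℝ) ^ n * x i⌋₊

/-- A coding `ε₁ ⋯ ε_n ↦ I_{ε₁ ⋯ ε_n}` of the `ℓ`-adic cubes by words over an alphabet with `ℓ^D`
letters: words of length `n` code the cubes of `𝓕_n` bijectively, compatibly with inclusion. -/
structure IsAdicCoding (ℓ D : ℕ)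
    (I : List (Fin (ℓ ^ D)) → Set (EuclideanSpace ℝ (Fin D))) : Prop where
  bijOn : ∀ n, BijOn I {w | w.length = n} (adicCubes ℓ D n)
  nested : ∀ w ε, I (w ++ [ε]) ⊆ I w

/-- The quasi-Bernoulli property `C⁻¹ m(I) m(J) ≤ m(IJ) ≤ C m(I) m(J)` for the coding `I`. -/
def IsQuasiBernoulli {ℓ D : ℕ} (I : List (Fin (ℓ ^ D)) → Set (EuclideanSpace ℝ (Fin D)))
    (m : Measure (EuclideanSpace ℝ (Fin D))) : Prop :=
  ∃ C : ℝ, 1 ≤ C ∧ ∀ u v : List (Fin (ℓ ^ D)),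
    1 / C * (m.real (I u) * m.real (I v)) ≤ m.real (I (u ++ v)) ∧
      m.real (I (u ++ v)) ≤ C * (m.real (I u) * m.real (I v))

variable (ℓ : ℕ) {D : ℕ} (m : Measure (EuclideanSpace ℝ (Fin D)))

/-- `τ_n(q) = (n log ℓ)⁻¹ log ∑_{I ∈ 𝓕_n} m(I)^q`; as usual, the cubes with `m(I) = 0` do not
contribute (this matters only for `q ≤ 0`, and ensures that `τ(0)` is the dimension of the
support). -/
def tauN (n : ℕ) (q : ℝ) : ℝ :=
  1 / (n * Real.log ℓ) *
    Real.log (∑ᶠ Q ∈ {Q ∈ adicCubes ℓ D n | 0 < m.real Q}, m.real Q ^ q)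

/-- The `L^q`-spectrum `τ(q) = limsup τ_n(q)`. -/
def tau (q : ℝ) : ℝ := limsup (fun n : ℕ => tauN ℓ m n q) atTop

/-- `d = -τ'(1)`. -/
def dimension : ℝ := -deriv (tau ℓ m) 1

/-- `χ(q) = τ(1 - q) - q d`. -/
def chi (q : ℝ) : ℝ := tau ℓ m (1 - q) - q * dimension ℓ m

/-- The inverse of `χ : [0,1] → [0, χ(1)]`. -/
def chiInv (y : ℝ) : ℝ := Function.invFunOn (chi ℓ m) (Icc 0 1) y

/-- `θ(t) = 1 / χ⁻¹(1/t)`; meaningful for `t ≥ 1 / χ(1)`. -/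
def theta (t : ℝ) : ℝ := 1 / chiInv ℓ m (1 / t)

/-- `X_n(x) = -log_ℓ (m(I_n(x)) / m(I_{n-1}(x)))`, `n ≥ 1`. -/
def X (n : ℕ) (x : EuclideanSpace ℝ (Fin D)) : ℝ :=
  -Real.logb ℓ (m.real (cubeAt ℓ D n x) / m.real (cubeAt ℓ D (n - 1) x))

/-- `S_n = X_1 + ⋯ + X_n`. -/
def S (n : ℕ) (x : EuclideanSpace ℝ (Fin D)) : ℝ := ∑ k ∈ Finset.Icc 1 n, X ℓ m k x

/-- The gauge `ψ_a(t) = t^d ℓ^{-a θ(log_ℓ (1/t))}`. Packing measures only depend on the values of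
the gauge at small `t > 0`. -/
def psi (a t : ℝ) : ℝ :=
  t ^ dimension ℓ m * (ℓ : ℝ) ^ (-(a * theta ℓ m (Real.logb ℓ (1 / t))))

end QuasiBernoulli

end

noncomputable section

open scoped Topology

namespace QuasiBernoulli

/-! ### Almost additive sequences -/

/-! Write `b = ℓ`. The proof is a Paley–Zygmund argument for S_n - nd under m, made uniform inside
every cube.

Quasi-multiplicativity makes log ∑ m(I)^q almost additive in n, so it equals n τ(q) log ℓ up to an
error bounded in n. At exponent 1 - q this says that the m-mean of b^(q(S_n - nd)) is comparable to
b^(nχ(q)), uniformly in n and q ∈ [0,1] (`partitionSum_bounds`). Here χ is convex with χ(0) = 0,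
hence strictly increasing where it is positive, which gives the bijection.

Take q = 1/θ(n), so that nχ(q) = 1, and l = 2^j. Convexity gives nχ(lq) ≥ l, and doubling gives
nχ(2lq) ≤ K^(j+1). For a < 1, points with S_n - nd < aθ(n) contribute at most b^(la) to the mean at
lq, which is at least b^l / C. For large l the other points carry half of it, and Cauchy–Schwarz
against the mean at 2lq bounds their mass below by a constant (`exists_le_sum_light`). The
quasi-Bernoulli property transports this into any cube (`exists_le_sum_append_light`), so the set of
points that eventually avoid the event is null (`ae_frequently_mem`). Letting a increase to 1 gives
the limsup.

For packing measures, a ball of radius ℓ^(-n) about almost every point eventually has mass at most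
(n+1)^2 times that of its cube. Doubling forces θ to grow at least like a power, so b^(ηθ(n))
absorbs this factor, and a Vitali covering gives absolute continuity. -/

theorem exists_linear_approx_of_almost_additive {a : ℕ → ℝ} {K : ℝ}
    (h : ∀ n p, |a (n + p) - (a n + a p)| ≤ K) : ∃ L : ℝ, ∀ n : ℕ, |a n - n * L| ≤ K := by
  -- Fekete's lemma is applied to both a + K and K - a. The two limits are opposite, and each bounds
  -- its sequence from one side.
  have hu : Subadditive fun n => a n + K := fun n p => by
    have := (abs_le.1 (h n p)).2
    linarith
  have hv : Subadditive fun n => K - a n := fun n p => by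
    have := (abs_le.1 (h n p)).1
    linarith
  have h0 : |a 0| ≤ K := by simpa using h 0 0
  have hlow : ∀ n : ℕ, n * (a 1 - K) ≤ a n + K := by
    intro n
    induction n with
    | zero => simpa using (by linarith [(abs_le.1 h0).1] : 0 ≤ a 0 + K)
    | succ n ih =>
      have := (abs_le.1 (h n 1)).1
      push_cast
      linarith
  have hbu : BddBelow (range fun n : ℕ => (a n + K) / n) := by
    -- The 0 accounts for the term n = 0, where division by zero gives 0.
    refine ⟨min 0 (a 1 - K), ?_⟩
    rintro _ ⟨n, rfl⟩
    rcases Nat.eq_zero_or_pos n with rfl | hn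
    · simp
    · refine (min_le_right _ _).trans ?_
      have : (0 : ℝ) < n := by exact_mod_cast hn
      rw [le_div_iff₀ this, mul_comm]
      exact hlow n
  have hK : Tendsto (fun n : ℕ => 2 * K / n) atTop (𝓝 0) := tendsto_const_div_atTop_nhds_zero_nat _
  have htv : Tendsto (fun n : ℕ => (K - a n) / n) atTop (𝓝 (-hu.lim)) := by
    have := hK.sub (hu.tendsto_lim hbu)
    rw [zero_sub] at this
    refine this.congr fun n => ?_
    ring
  have hbv := htv.bddBelow_range
  have hlim : hv.lim = -hu.lim := tendsto_nhds_unique (hv.tendsto_lim hbv) htv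
  refine ⟨hu.lim, fun n => ?_⟩
  rcases Nat.eq_zero_or_pos n with rfl | hn
  · simpa using h0
  · have hn' : (0 : ℝ) < n := by exact_mod_cast hn
    have h1 := hu.lim_le_div hbu hn.ne'
    have h2 := hv.lim_le_div hbv hn.ne'
    rw [hlim] at h2
    rw [le_div_iff₀ hn'] at h1 h2
    rw [abs_le]
    constructor <;> linarith

/-! ### Words -/

section Words

variable {α : Type*} [Fintype α]

/-- The words of length `n`. -/
def words (α : Type*) [Fintype α] (n : ℕ) : Finset (List α) :=
  (List.finite_length_eq α n).toFinset

@[simp]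
theorem mem_words {n : ℕ} {w : List α} : w ∈ words α n ↔ w.length = n := by
  simp [words]

theorem coe_words (n : ℕ) : (words α n : Set (List α)) = {w | w.length = n} := by
  ext w
  simp

theorem sum_words_add (n p : ℕ) (f : List α → ℝ) :
    ∑ w ∈ words α (n + p), f w = ∑ u ∈ words α n, ∑ v ∈ words α p, f (u ++ v) := by
  rw [← Finset.sum_product']
  refine Finset.sum_bij' (fun w _ => (w.take n, w.drop n)) (fun z _ => z.1 ++ z.2) ?_ ?_ ?_ ?_ ?_
  · intro w hw
    simp only [mem_words] at hw
    simp [hw]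
  · rintro ⟨u, v⟩ h
    simp only [Finset.mem_product, mem_words] at h
    simp [h.1, h.2]
  · intro w _
    simp
  · rintro ⟨u, v⟩ h
    simp only [Finset.mem_product, mem_words] at h
    simp [h.1]
  · intro w _
    simp

/-- A quasi-Bernoulli weight on words: the masses of the cubes, as a function of their codes. -/
structure IsQuasiBernoulliWeight (μ : List α → ℝ) (C : ℝ) : Prop where
  nonneg : ∀ w, 0 ≤ μ w
  sum_eq_one : ∀ n, ∑ w ∈ words α n, μ w = 1
  one_le : 1 ≤ C
  lower : ∀ u v, 1 / C * (μ u * μ v) ≤ μ (u ++ v)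
  upper : ∀ u v, μ (u ++ v) ≤ C * (μ u * μ v)

/-- The partition function `∑ μ(w) ^ q`, over the words `w` of length `n` with `μ(w) > 0`. -/
def partitionSum (μ : List α → ℝ) (n : ℕ) (q : ℝ) : ℝ :=
  ∑ w ∈ words α n with 0 < μ w, μ w ^ q

/-! ### Partition functions: almost multiplicativity in n and log-convexity in q. -/

namespace IsQuasiBernoulliWeight

variable {μ : List α → ℝ} {C : ℝ} (h : IsQuasiBernoulliWeight μ C)

include h

theorem pos : 0 < C := zero_lt_one.trans_le h.one_le

theorem le_one (w : List α) : μ w ≤ 1 := by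
  rw [← h.sum_eq_one w.length]
  exact Finset.single_le_sum (fun w _ => h.nonneg w) (by simp)

theorem append_pos_iff {u v : List α} : 0 < μ (u ++ v) ↔ 0 < μ u ∧ 0 < μ v := by
  constructor
  · intro huv
    have h1 : 0 < C * (μ u * μ v) := huv.trans_le (h.upper u v)
    have h2 : 0 < μ u * μ v := pos_of_mul_pos_right h1 h.pos.le
    exact ⟨pos_of_mul_pos_left h2 (h.nonneg v), pos_of_mul_pos_right h2 (h.nonneg u)⟩
  · rintro ⟨hu, hv⟩
    have := h.pos
    exact lt_of_lt_of_le (by positivity) (h.lower u v)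

theorem partitionSum_pos (n : ℕ) (q : ℝ) : 0 < partitionSum μ n q := by
  refine Finset.sum_pos (fun w hw => Real.rpow_pos_of_pos (Finset.mem_filter.1 hw).2 q) ?_
  by_contra hne
  have h0 : ∑ w ∈ words α n, μ w = 0 := by
    refine Finset.sum_eq_zero fun w hw => ?_
    by_contra hw0
    exact hne ⟨w, Finset.mem_filter.2 ⟨hw, lt_of_le_of_ne (h.nonneg w) (Ne.symm hw0)⟩⟩
  rw [h.sum_eq_one] at h0
  exact one_ne_zero h0

theorem sum_pos_eq_one (n : ℕ) : ∑ w ∈ words α n with 0 < μ w, μ w = 1 := by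
  rw [← h.sum_eq_one n]
  refine Finset.sum_filter_of_ne fun w _ hw => lt_of_le_of_ne (h.nonneg w) hw.symm

theorem partitionSum_one (n : ℕ) : partitionSum μ n 1 = 1 := by
  simp only [partitionSum, Real.rpow_one]
  exact h.sum_pos_eq_one n

theorem rpow_append_bounds {u v : List α} (hu : 0 < μ u) (hv : 0 < μ v) (q : ℝ) :
    (C ^ |q|)⁻¹ * (μ u ^ q * μ v ^ q) ≤ μ (u ++ v) ^ q ∧
      μ (u ++ v) ^ q ≤ C ^ |q| * (μ u ^ q * μ v ^ q) := by
  have hC := h.pos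
  have hP : 0 < μ u * μ v := mul_pos hu hv
  have hl := h.lower u v
  have hr := h.upper u v
  have huv := h.append_pos_iff.2 ⟨hu, hv⟩
  rw [← Real.mul_rpow hu.le hv.le, ← Real.rpow_neg hC.le]
  rcases le_total 0 q with hq | hq
  · rw [abs_of_nonneg hq, Real.rpow_neg hC.le, ← Real.inv_rpow hC.le,
      ← Real.mul_rpow (by positivity) hP.le, ← Real.mul_rpow hC.le hP.le]
    rw [one_div] at hl
    exact ⟨Real.rpow_le_rpow (by positivity) hl hq, Real.rpow_le_rpow huv.le hr hq⟩
  · rw [abs_of_nonpos hq, neg_neg, Real.rpow_neg hC.le, ← Real.inv_rpow hC.le,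
      ← Real.mul_rpow hC.le hP.le, ← Real.mul_rpow (by positivity) hP.le]
    rw [one_div] at hl
    exact ⟨Real.rpow_le_rpow_of_nonpos huv hr hq,
      Real.rpow_le_rpow_of_nonpos (by positivity) hl hq⟩

/-- A concatenation has positive mass exactly when both factors do, so the restricted sums factor
over pairs (u, v) and the bounds hold term by term, also for negative q. -/
theorem partitionSum_add_bounds (n p : ℕ) (q : ℝ) :
    (C ^ |q|)⁻¹ * (partitionSum μ n q * partitionSum μ p q) ≤ partitionSum μ (n + p) q ∧
      partitionSum μ (n + p) q ≤ C ^ |q| * (partitionSum μ n q * partitionSum μ p q) := by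
  simp only [partitionSum, Finset.sum_filter]
  rw [sum_words_add, Finset.sum_mul_sum, Finset.mul_sum, Finset.mul_sum]
  simp only [Finset.mul_sum, h.append_pos_iff]
  constructor
  · refine Finset.sum_le_sum fun u _ => Finset.sum_le_sum fun v _ => ?_
    by_cases hu : 0 < μ u <;> by_cases hv : 0 < μ v <;> simp only [hu, hv, and_self, and_true,
      and_false, if_true, if_false, mul_zero, zero_mul, le_refl]
    exact (h.rpow_append_bounds hu hv q).1
  · refine Finset.sum_le_sum fun u _ => Finset.sum_le_sum fun v _ => ?_
    by_cases hu : 0 < μ u <;> by_cases hv : 0 < μ v <;> simp only [hu, hv, and_self, and_true,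
      and_false, if_true, if_false, mul_zero, zero_mul, le_refl]
    exact (h.rpow_append_bounds hu hv q).2

theorem exists_log_partitionSum_approx (q : ℝ) :
    ∃ L : ℝ, ∀ n : ℕ, |Real.log (partitionSum μ n q) - n * L| ≤ |q| * Real.log C := by
  refine exists_linear_approx_of_almost_additive fun n p => ?_
  have hC := h.pos
  obtain ⟨h1, h2⟩ := h.partitionSum_add_bounds n p q
  have hn := h.partitionSum_pos n q
  have hp := h.partitionSum_pos p q
  have hnp := h.partitionSum_pos (n + p) q
  have hCq : 0 < C ^ |q| := Real.rpow_pos_of_pos hC _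
  have l1 := Real.log_le_log (by positivity) h1
  have l2 := Real.log_le_log hnp h2
  rw [Real.log_mul (by positivity) (by positivity), Real.log_mul hn.ne' hp.ne', Real.log_inv,
    Real.log_rpow hC] at l1
  rw [Real.log_mul (by positivity) (by positivity), Real.log_mul hn.ne' hp.ne',
    Real.log_rpow hC] at l2
  rw [abs_le]
  constructor <;> linarith

/-- This is Hölder's inequality, obtained by summing the weighted AM-GM inequality for the terms
normalised by their partition sums. -/
theorem convexOn_log_partitionSum (n : ℕ) :
    ConvexOn ℝ univ fun q => Real.log (partitionSum μ n q) := by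
  refine ⟨convex_univ, fun x _ y _ a b ha hb hab => ?_⟩
  have hx := h.partitionSum_pos n x
  have hy := h.partitionSum_pos n y
  have hxa : 0 < partitionSum μ n x ^ a := Real.rpow_pos_of_pos hx a
  have hyb : 0 < partitionSum μ n y ^ b := Real.rpow_pos_of_pos hy b
  simp only [smul_eq_mul]
  rw [← Real.log_rpow hx, ← Real.log_rpow hy, ← Real.log_mul hxa.ne' hyb.ne']
  refine Real.log_le_log (h.partitionSum_pos n _) ?_
  have key : ∀ w ∈ (words α n).filter (0 < μ ·), μ w ^ (a * x + b * y)
      ≤ partitionSum μ n x ^ a * partitionSum μ n y ^ b *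
        (a * (μ w ^ x / partitionSum μ n x) + b * (μ w ^ y / partitionSum μ n y)) := by
    intro w hw
    have hw0 : 0 < μ w := (Finset.mem_filter.1 hw).2
    have hwx := Real.rpow_pos_of_pos hw0 x
    have hwy := Real.rpow_pos_of_pos hw0 y
    have := Real.geom_mean_le_arith_mean2_weighted ha hb (div_nonneg hwx.le hx.le)
      (div_nonneg hwy.le hy.le) hab
    rw [Real.div_rpow hwx.le hx.le, Real.div_rpow hwy.le hy.le, div_mul_div_comm,
      div_le_iff₀ (by positivity), ← Real.rpow_mul hw0.le, ← Real.rpow_mul hw0.le,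
      ← Real.rpow_add hw0] at this
    rw [mul_comm a x, mul_comm b y]
    linarith
  refine (Finset.sum_le_sum key).trans (le_of_eq ?_)
  rw [← Finset.mul_sum, Finset.sum_add_distrib, ← Finset.mul_sum, ← Finset.mul_sum,
    ← Finset.sum_div, ← Finset.sum_div]
  change _ * (a * (partitionSum μ n x / partitionSum μ n x) +
    b * (partitionSum μ n y / partitionSum μ n y)) = _
  rw [div_self hx.ne', div_self hy.ne', mul_one, mul_one, hab, mul_one]

end IsQuasiBernoulliWeight

end Words

/-! ### Convex rate functions with the doubling property -/

/-- A convex function vanishing at `0`, positive on `(0, 1]`, with the doubling property there. -/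
structure IsDoublingRate (χ : ℝ → ℝ) (K : ℝ) : Prop where
  convex : ConvexOn ℝ univ χ
  zero : χ 0 = 0
  pos : ∀ q ∈ Ioc (0 : ℝ) 1, 0 < χ q
  doubling : ∀ q ∈ Ioc (0 : ℝ) 1, χ q ≤ K * χ (q / 2)

/-- `1 / χ⁻¹(1 / t)`, where `χ⁻¹` is the inverse of `χ` on `[0, 1]`. -/
def rateScale (χ : ℝ → ℝ) (t : ℝ) : ℝ := 1 / Function.invFunOn χ (Icc 0 1) (1 / t)

namespace IsDoublingRate

variable {χ : ℝ → ℝ} {K : ℝ} (h : IsDoublingRate χ K)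

include h

theorem map_mul_le {s q : ℝ} (hs0 : 0 ≤ s) (hs1 : s ≤ 1) : χ (s * q) ≤ s * χ q := by
  have := h.convex.2 (mem_univ q) (mem_univ 0) hs0 (sub_nonneg.2 hs1) (by ring)
  simpa [h.zero] using this

theorem strictMonoOn : StrictMonoOn χ (Icc 0 1) := by
  intro x hx y hy hxy
  have hy0 : 0 < y := hx.1.trans_lt hxy
  have hy' := h.pos y ⟨hy0, hy.2⟩
  have h1 := h.map_mul_le (q := y) (div_nonneg hx.1 hy0.le) ((div_le_one hy0).2 hxy.le)
  rw [div_mul_cancel₀ _ hy0.ne'] at h1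
  exact h1.trans_lt (mul_lt_of_lt_one_left hy' ((div_lt_one hy0).2 hxy))

theorem bijOn : BijOn χ (Icc 0 1) (Icc 0 (χ 1)) := by
  refine ⟨fun x hx => ?_, h.strictMonoOn.injOn, ?_⟩
  · constructor
    · rw [← h.zero]
      exact h.strictMonoOn.monotoneOn (by simp) hx hx.1
    · exact h.strictMonoOn.monotoneOn hx (by simp) hx.2
  · have hc : ContinuousOn χ (Icc 0 1) := (h.convex.continuousOn isOpen_univ).mono (subset_univ _)
    have := intermediate_value_Icc zero_le_one hc
    rwa [h.zero] at this

theorem one_pos : 0 < χ 1 := h.pos 1 (by simp)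

theorem inv_rateScale {t : ℝ} (ht : 1 / χ 1 ≤ t) :
    1 / rateScale χ t ∈ Ioc (0 : ℝ) 1 ∧ χ (1 / rateScale χ t) = 1 / t := by
  have ht0 : 0 < t := lt_of_lt_of_le (one_div_pos.2 h.one_pos) ht
  have hmem : 1 / t ∈ χ '' Icc 0 1 := by
    rw [h.bijOn.image_eq]
    refine ⟨by positivity, ?_⟩
    rwa [one_div_le ht0 h.one_pos]
  have h1 := Function.invFunOn_mem hmem
  have h2 := Function.invFunOn_eq hmem
  rw [rateScale, one_div_one_div]
  refine ⟨⟨lt_of_le_of_ne h1.1 ?_, h1.2⟩, h2⟩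
  intro h0
  rw [← h0, h.zero] at h2
  exact (one_div_pos.2 ht0).ne h2

theorem rateScale_pos {t : ℝ} (ht : 1 / χ 1 ≤ t) : 0 < rateScale χ t :=
  one_div_pos.1 (h.inv_rateScale ht).1.1

/-- The scale divided by its argument is nonincreasing: convexity gives χ((s/t)/θ(s)) ≤ (s/t)(1/s) =
1/t = χ(1/θ(t)), and χ is increasing. -/
theorem rateScale_le_mul {s t : ℝ} (hs : 1 / χ 1 ≤ s) (hst : s ≤ t) :
    rateScale χ t ≤ t / s * rateScale χ s := by
  have hs0 : 0 < s := lt_of_lt_of_le (one_div_pos.2 h.one_pos) hs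
  have ht0 := hs0.trans_le hst
  obtain ⟨⟨hp, hp1⟩, hpe⟩ := h.inv_rateScale hs
  obtain ⟨⟨hq, hq1⟩, hqe⟩ := h.inv_rateScale (hs.trans hst)
  have hr1 : s / t ≤ 1 := (div_le_one ht0).2 hst
  have h1 := h.map_mul_le (q := 1 / rateScale χ s) (div_nonneg hs0.le ht0.le) hr1
  have hst' : s / t * (1 / s) = 1 / t := by field_simp
  rw [hpe, hst', ← hqe] at h1
  have h2 := (h.strictMonoOn.le_iff_le
    ⟨by positivity, (mul_le_of_le_one_left hp.le hr1).trans hp1⟩ ⟨hq.le, hq1⟩).1 h1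
  have hS := h.rateScale_pos hs
  have hT := h.rateScale_pos (hs.trans hst)
  have h3 := (one_div_le_one_div_of_le (by positivity) h2)
  rw [one_div_one_div] at h3
  refine h3.trans (le_of_eq ?_)
  field_simp

theorem constant_pos : 0 < K := by
  by_contra! hK
  have h1 := h.doubling 1 (by simp)
  have h2 := h.pos (1 / 2) (by norm_num)
  nlinarith [h.one_pos]

theorem map_pow_two_mul_le {q : ℝ} (hq : 0 < q) (j : ℕ) (hj : 2 ^ j * q ≤ 1) :
    χ (2 ^ j * q) ≤ K ^ j * χ q := by
  induction j with
  | zero => simp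
  | succ j ih =>
    have hle : 2 ^ j * q ≤ 1 := by
      refine le_trans ?_ hj
      have : (0 : ℝ) < 2 ^ j * q := by positivity
      rw [pow_succ]
      linarith
    have h1 := h.doubling (2 ^ (j + 1) * q) ⟨by positivity, hj⟩
    have h2 : 2 ^ (j + 1) * q / 2 = 2 ^ j * q := by ring
    rw [h2] at h1
    refine h1.trans ?_
    rw [pow_succ' K, mul_assoc]
    exact mul_le_mul_of_nonneg_left (ih hle) h.constant_pos.le

theorem le_map_pow_two_mul {q : ℝ} (j : ℕ) : 2 ^ j * χ q ≤ χ (2 ^ j * q) := by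
  have h1 := h.map_mul_le (s := ((2 : ℝ) ^ j)⁻¹) (q := 2 ^ j * q) (by positivity)
    (inv_le_one_of_one_le₀ (one_le_pow₀ (by norm_num)))
  rw [inv_mul_cancel_left₀ (by positivity)] at h1
  rwa [← le_inv_mul_iff₀ (by positivity)]

/-- A doubling rate is bounded below by a power, so that its scale grows at least like a power. -/
theorem exists_le_mul_rateScale_pow :
    ∃ (B : ℝ) (k : ℕ), 0 < B ∧ ∀ t, 1 / χ 1 ≤ t → t ≤ B * rateScale χ t ^ k := by
  obtain ⟨k, hk⟩ := pow_unbounded_of_one_lt K (one_lt_two : (1 : ℝ) < 2)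
  refine ⟨2 ^ k / χ 1, k, div_pos (by positivity) h.one_pos, fun t ht => ?_⟩
  have ht0 : 0 < t := lt_of_lt_of_le (one_div_pos.2 h.one_pos) ht
  obtain ⟨⟨hq0, hq1⟩, hqe⟩ := h.inv_rateScale ht
  have hS := h.rateScale_pos ht
  set q := 1 / rateScale χ t with hq
  -- With q located between consecutive powers of 1/2, doubling iterated from 1 down to 2^(-(j+1)),
  -- together with K < 2^k, bounds χ(q) below by a multiple of q^k.
  obtain ⟨j, hj1, hj2⟩ := exists_nat_pow_near_of_lt_one hq0 hq1 (one_half_pos (α := ℝ))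
    one_half_lt_one
  have hχ : χ 1 ≤ K ^ (j + 1) * χ ((1 / 2) ^ (j + 1)) := by
    have := h.map_pow_two_mul_le (q := (1 / 2) ^ (j + 1)) (by positivity) (j + 1)
      (by rw [← mul_pow]; norm_num)
    rwa [← mul_pow, mul_one_div_cancel two_ne_zero, one_pow] at this
  have hmono : χ ((1 / 2) ^ (j + 1)) ≤ χ q :=
    h.strictMonoOn.monotoneOn ⟨by positivity, hj1.le.trans hq1⟩ ⟨hq0.le, hq1⟩ hj1.le
  have hKj : K ^ (j + 1) ≤ (2 ^ k * rateScale χ t ^ k) := by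
    calc K ^ (j + 1) ≤ (2 ^ k) ^ (j + 1) := pow_le_pow_left₀ h.constant_pos.le hk.le _
      _ = (2 * 2 ^ j) ^ k := by rw [← pow_mul, mul_comm, pow_mul, pow_succ']
      _ ≤ (2 * rateScale χ t) ^ k := by
        refine pow_le_pow_left₀ (by positivity) (mul_le_mul_of_nonneg_left ?_ zero_le_two) _
        rw [hq, one_div_pow] at hj2
        exact (one_div_le_one_div hS (by positivity)).1 hj2
      _ = _ := mul_pow _ _ _
  have h3 : χ 1 ≤ 2 ^ k * rateScale χ t ^ k * (1 / t) := by
    rw [← hqe]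
    refine hχ.trans ?_
    refine mul_le_mul hKj hmono (h.pos _ ⟨by positivity, hj1.le.trans hq1⟩).le (by positivity)
  rw [mul_one_div, le_div_iff₀ ht0] at h3
  rw [div_mul_eq_mul_div, le_div_iff₀ h.one_pos]
  linarith

theorem tendsto_rateScale : Tendsto (fun n : ℕ => rateScale χ n) atTop atTop := by
  obtain ⟨B, k, hB, hk⟩ := h.exists_le_mul_rateScale_pow
  refine tendsto_atTop.2 fun M => ?_
  have hM : ∀ᶠ n : ℕ in atTop, B * |M| ^ k < n :=
    tendsto_natCast_atTop_atTop.eventually_gt_atTop _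
  have h1 : ∀ᶠ n : ℕ in atTop, 1 / χ 1 ≤ (n : ℝ) :=
    tendsto_natCast_atTop_atTop.eventually_ge_atTop _
  filter_upwards [hM, h1] with n hn hn1
  by_contra! hlt
  have hS := h.rateScale_pos hn1
  have := hk n hn1
  have h2 : rateScale χ n ^ k ≤ |M| ^ k :=
    pow_le_pow_left₀ hS.le (hlt.le.trans (le_abs_self M)) _
  have := mul_le_mul_of_nonneg_left h2 hB.le
  linarith

/-- Shifting the argument of the scale, and adding a constant, costs only a factor close to `1`. -/
theorem eventually_scale_add_le {a b : ℝ} (ha : 0 < a) (hab : a < b) (N : ℕ) (R : ℝ) :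
    ∀ᶠ n : ℕ in atTop, R + a * rateScale χ ((N + n : ℕ) : ℝ) ≤ b * rateScale χ n := by
  have h1 : ∀ᶠ n : ℕ in atTop, 1 / χ 1 ≤ (n : ℝ) :=
    tendsto_natCast_atTop_atTop.eventually_ge_atTop _
  -- Half of the gap b - a pays for the factor (N + n)/n, the other half for R.
  have h2 : ∀ᶠ n : ℕ in atTop, 2 * a * N / (b - a) ≤ (n : ℝ) :=
    tendsto_natCast_atTop_atTop.eventually_ge_atTop _
  have h3 := h.tendsto_rateScale.eventually_ge_atTop (2 * R / (b - a))
  filter_upwards [h1, h2, h3] with n hn1 hn2 hn3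
  have hba : 0 < b - a := sub_pos.2 hab
  have hn0 : (0 : ℝ) < n := lt_of_lt_of_le (one_div_pos.2 h.one_pos) hn1
  have hS := h.rateScale_pos hn1
  have h4 := h.rateScale_le_mul hn1 (t := ((N + n : ℕ) : ℝ)) (by push_cast; simp)
  rw [div_le_iff₀ hba] at hn2 hn3
  have h5 : a * (((N + n : ℕ) : ℝ) / n) ≤ (a + b) / 2 := by
    rw [mul_div_assoc', div_le_iff₀ hn0]
    push_cast
    linarith
  have h6 := mul_le_mul_of_nonneg_left h4 ha.le
  have h7 := mul_le_mul_of_nonneg_right h5 hS.le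
  linarith

end IsDoublingRate

/-! ### Light words -/

section Words

variable {α : Type*} [Fintype α]

/-- `w` has positive mass at most `b ^ (-(n d + s))`. -/
def IsLight (μ : List α → ℝ) (b d : ℝ) (n : ℕ) (s : ℝ) (w : List α) : Prop :=
  0 < μ w ∧ μ w ≤ b ^ (-(n * d + s))

open Classical in
-- Paley–Zygmund for exponential moments at the scale where nχ(q) = 1; the lower bound c does not
-- depend on n.
theorem IsQuasiBernoulliWeight.exists_le_sum_light {μ : List α → ℝ} {C : ℝ}
    (h : IsQuasiBernoulliWeight μ C) {χ : ℝ → ℝ} {K : ℝ} (hχ : IsDoublingRate χ K) {b d : ℝ}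
    (hb : 1 < b)
    (hZ : ∀ n : ℕ, ∀ q ∈ Icc (0 : ℝ) 1, C⁻¹ * b ^ (n * (χ q + q * d)) ≤ partitionSum μ n (1 - q) ∧
      partitionSum μ n (1 - q) ≤ C * b ^ (n * (χ q + q * d)))
    {a : ℝ} (ha1 : a < 1) :
    ∃ c > 0, ∀ᶠ n : ℕ in atTop,
      c ≤ ∑ w ∈ words α n with IsLight μ b d n (a * rateScale χ n) w, μ w := by
  have hC := h.pos
  have hb0 : 0 < b := zero_lt_one.trans hb
  have htend : Tendsto (fun j : ℕ => b ^ ((1 - a) * (2 : ℝ) ^ j)) atTop atTop := by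
    refine (tendsto_rpow_atTop_of_base_gt_one b hb).comp ?_
    exact (tendsto_pow_atTop_atTop_of_one_lt one_lt_two).const_mul_atTop (sub_pos.2 ha1)
  -- Since a < 1, a large l = 2^j makes b^(la) at most half of the lower bound b^l / C for the
  -- moment at lq.
  obtain ⟨j, hj⟩ := (htend.eventually_ge_atTop (2 * C)).exists
  set l : ℝ := 2 ^ j with hl
  have hl0 : 0 < l := by positivity
  have hjl : b ^ (l * a) ≤ C⁻¹ * b ^ l / 2 := by
    have : b ^ l = b ^ ((1 - a) * l) * b ^ (l * a) := by
      rw [← Real.rpow_add hb0]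
      congr 1
      ring
    rw [this, le_div_iff₀ two_pos, inv_mul_eq_div, le_div_iff₀ hC]
    have hp := Real.rpow_pos_of_pos hb0 (l * a)
    nlinarith
  set x₀ : ℝ := C⁻¹ * b ^ l / 2 with hx₀
  have hx₀p : 0 < x₀ := by positivity
  set M : ℝ := C * b ^ (K ^ (j + 1)) with hM
  have hMp : 0 < M := by positivity
  refine ⟨x₀ ^ 2 / M, by positivity, ?_⟩
  have h1 : ∀ᶠ n : ℕ in atTop, 1 / χ 1 ≤ (n : ℝ) :=
    tendsto_natCast_atTop_atTop.eventually_ge_atTop _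
  -- This keeps both lq and 2lq in [0,1], where the moment bounds apply.
  have h2 := hχ.tendsto_rateScale.eventually_ge_atTop (2 ^ (j + 1))
  filter_upwards [h1, h2] with n hn1 hn2
  have hn0 : (0 : ℝ) < n := lt_of_lt_of_le (one_div_pos.2 hχ.one_pos) hn1
  obtain ⟨⟨hq0, hq1⟩, hqe⟩ := hχ.inv_rateScale hn1
  have hS := hχ.rateScale_pos hn1
  set q := 1 / rateScale χ n with hq
  have hqS : q * rateScale χ n = 1 := one_div_mul_cancel hS.ne'
  have hlq2 : 2 ^ (j + 1) * q ≤ 1 := by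
    rw [hq, mul_one_div, div_le_one hS]
    exact hn2
  have hlq : l * q ≤ 1 := by
    rw [pow_succ] at hlq2
    nlinarith
  have hlow : l ≤ n * χ (l * q) := by
    have := hχ.le_map_pow_two_mul (q := q) j
    rw [hqe, mul_one_div, div_le_iff₀ hn0] at this
    linarith
  have hup : n * χ (2 ^ (j + 1) * q) ≤ K ^ (j + 1) := by
    have := hχ.map_pow_two_mul_le hq0 (j + 1) hlq2
    rw [hqe, mul_one_div (K ^ (j + 1)), le_div_iff₀ hn0] at this
    linarith
  set E : ℝ := b ^ (n * (l * q * d)) with hE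
  have hEp : 0 < E := Real.rpow_pos_of_pos hb0 _
  have hZ1 := (hZ n (l * q) ⟨by positivity, hlq⟩).1
  have hZ2 := (hZ n (2 ^ (j + 1) * q) ⟨by positivity, hlq2⟩).2
  set P := ∑ w ∈ words α n with IsLight μ b d n (a * rateScale χ n) w, μ w with hP
  set Y := ∑ w ∈ words α n with IsLight μ b d n (a * rateScale χ n) w, μ w ^ (1 - l * q) with hY
  have hZ1' : C⁻¹ * b ^ l * E ≤ partitionSum μ n (1 - l * q) := by
    refine le_trans ?_ hZ1
    rw [mul_assoc, hE, ← Real.rpow_add hb0]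
    refine mul_le_mul_of_nonneg_left ?_ (by positivity)
    refine Real.rpow_le_rpow_of_exponent_le hb.le ?_
    linarith
  have hZ2' : partitionSum μ n (1 - 2 ^ (j + 1) * q) ≤ M * E ^ 2 := by
    refine hZ2.trans ?_
    rw [hM, mul_assoc C, hE, ← Real.rpow_natCast (b ^ _) 2, ← Real.rpow_mul hb0.le,
      ← Real.rpow_add hb0]
    refine mul_le_mul_of_nonneg_left ?_ hC.le
    refine Real.rpow_le_rpow_of_exponent_le hb.le ?_
    rw [pow_succ] at hup ⊢
    push_cast
    linarith
  -- A word of positive mass that is not light has μ(w)^(-lq) ≤ b^(lq(nd + aθ(n))) = b^(la) E,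
  -- because qθ(n) = 1.
  have hsplit : partitionSum μ n (1 - l * q) ≤ Y + b ^ (l * a) * E := by
    have hsub : partitionSum μ n (1 - l * q) = Y +
        ∑ w ∈ ((words α n).filter (0 < μ ·)).filter
          (¬ IsLight μ b d n (a * rateScale χ n) ·), μ w ^ (1 - l * q) := by
      rw [partitionSum, ← Finset.sum_filter_add_sum_filter_not ((words α n).filter (0 < μ ·))
        (IsLight μ b d n (a * rateScale χ n)), Finset.filter_filter, hY]
      congr 2
      ext w
      simp only [Finset.mem_filter, and_congr_right_iff, and_iff_right_iff_imp]
      exact fun _ hw => hw.1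
    rw [hsub]
    refine add_le_add le_rfl ?_
    calc _ ≤ ∑ w ∈ ((words α n).filter (0 < μ ·)).filter
          (¬ IsLight μ b d n (a * rateScale χ n) ·), b ^ (l * a) * E * μ w := by
          refine Finset.sum_le_sum fun w hw => ?_
          simp only [Finset.mem_filter, IsLight, not_and, not_le] at hw
          have hw0 : 0 < μ w := hw.1.2
          rw [Real.rpow_sub hw0, Real.rpow_one, div_eq_mul_inv, mul_comm,
            ← Real.rpow_neg hw0.le]
          refine mul_le_mul_of_nonneg_right ?_ hw0.le
          have := Real.rpow_le_rpow_of_nonpos (z := -(l * q)) (by positivity) (hw.2 hw0).le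
            (by nlinarith)
          refine this.trans (le_of_eq ?_)
          rw [← Real.rpow_mul hb0.le, hE, ← Real.rpow_add hb0]
          congr 1
          linear_combination l * a * hqS
      _ = b ^ (l * a) * E * ∑ w ∈ ((words α n).filter (0 < μ ·)).filter
          (¬ IsLight μ b d n (a * rateScale χ n) ·), μ w := by rw [Finset.mul_sum]
      _ ≤ b ^ (l * a) * E * ∑ w ∈ (words α n).filter (0 < μ ·), μ w := by
          refine mul_le_mul_of_nonneg_left ?_ (by positivity)
          exact Finset.sum_le_sum_of_subset_of_nonneg (Finset.filter_subset _ _)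
            fun w _ _ => h.nonneg w
      _ = _ := by rw [h.sum_pos_eq_one, mul_one]
  have hYlow : x₀ * E ≤ Y := by
    have : b ^ (l * a) * E ≤ x₀ * E := mul_le_mul_of_nonneg_right hjl hEp.le
    have h2x : C⁻¹ * b ^ l * E = 2 * (x₀ * E) := by rw [hx₀]; ring
    linarith
  have hP0 : 0 ≤ P := Finset.sum_nonneg fun w _ => h.nonneg w
  have hCS : Y ^ 2 ≤ P * (M * E ^ 2) := by
    -- Cauchy–Schwarz with the square of μ^(1 - lq) written as μ · μ^(1 - 2lq).
    have hcs := Finset.sum_sq_le_sum_mul_sum_of_sq_le_mul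
      ((words α n).filter (IsLight μ b d n (a * rateScale χ n)))
      (r := fun w => μ w ^ (1 - l * q)) (f := μ) (g := fun w => μ w ^ (1 - 2 ^ (j + 1) * q))
      (fun w _ => h.nonneg w) (fun w _ => Real.rpow_nonneg (h.nonneg w) _) (by
        intro w hw
        have hw0 : 0 < μ w := (Finset.mem_filter.1 hw).2.1
        refine le_of_eq ?_
        rw [← Real.rpow_natCast (μ w ^ _) 2, ← Real.rpow_mul hw0.le]
        nth_rewrite 2 [← Real.rpow_one (μ w)]
        rw [← Real.rpow_add hw0]
        congr 1
        rw [hl]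
        push_cast
        ring)
    refine hcs.trans (mul_le_mul_of_nonneg_left (le_trans ?_ hZ2') hP0)
    refine Finset.sum_le_sum_of_subset_of_nonneg ?_ fun w _ _ => Real.rpow_nonneg (h.nonneg w) _
    intro w hw
    simp only [Finset.mem_filter] at hw ⊢
    exact ⟨hw.1, hw.2.1⟩
  have hfin : (x₀ * E) ^ 2 ≤ P * (M * E ^ 2) :=
    (pow_le_pow_left₀ (by positivity) hYlow 2).trans hCS
  rw [div_le_iff₀ hMp]
  have hE2 : 0 < E ^ 2 := by positivity
  refine le_of_mul_le_mul_right ?_ hE2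
  linarith

open Classical in
-- Light suffixes occur after any prefix u with conditional mass bounded below. The suffixes are
-- taken light for some a' ∈ (a, 1); the margin a' - a absorbs the constant C, the term Nd and the
-- shift of the scale by N. The constant c is independent of N, and n is independent of u.
theorem IsQuasiBernoulliWeight.exists_le_sum_append_light {μ : List α → ℝ} {C : ℝ}
    (h : IsQuasiBernoulliWeight μ C) {χ : ℝ → ℝ} {K : ℝ} (hχ : IsDoublingRate χ K) {b d : ℝ}
    (hb : 1 < b)
    (hZ : ∀ n : ℕ, ∀ q ∈ Icc (0 : ℝ) 1, C⁻¹ * b ^ (n * (χ q + q * d)) ≤ partitionSum μ n (1 - q) ∧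
      partitionSum μ n (1 - q) ≤ C * b ^ (n * (χ q + q * d)))
    {a : ℝ} (ha0 : 0 < a) (ha1 : a < 1) :
    ∃ c > 0, ∀ N : ℕ, ∃ n : ℕ, ∀ u ∈ words α N, c * μ u ≤
      ∑ v ∈ words α n with
        IsLight μ b d (N + n) (a * rateScale χ ((N + n : ℕ) : ℝ)) (u ++ v), μ (u ++ v) := by
  have hC := h.pos
  have hb0 : 0 < b := zero_lt_one.trans hb
  obtain ⟨a', haa', ha'1⟩ := exists_between ha1
  obtain ⟨c, hc, hev⟩ := h.exists_le_sum_light hχ hb hZ ha'1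
  refine ⟨1 / C * c, by positivity, fun N => ?_⟩
  obtain ⟨n, hn1, hn2⟩ :=
    (hev.and (hχ.eventually_scale_add_le ha0 haa' N (Real.logb b C + N * d))).exists
  refine ⟨n, fun u _ => ?_⟩
  rcases (h.nonneg u).eq_or_lt with hu | hu
  · rw [← hu, mul_zero]
    exact Finset.sum_nonneg fun v _ => h.nonneg _
  · calc 1 / C * c * μ u ≤ ∑ v ∈ words α n with IsLight μ b d n (a' * rateScale χ n) v,
          1 / C * (μ u * μ v) := by
          rw [← Finset.mul_sum, ← Finset.mul_sum, mul_assoc, mul_comm c]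
          gcongr
      _ ≤ ∑ v ∈ words α n with IsLight μ b d n (a' * rateScale χ n) v, μ (u ++ v) :=
          Finset.sum_le_sum fun v _ => h.lower u v
      _ ≤ _ := by
          refine Finset.sum_le_sum_of_subset_of_nonneg ?_ fun v _ _ => h.nonneg _
          intro v hv
          simp only [Finset.mem_filter] at hv ⊢
          refine ⟨hv.1, h.append_pos_iff.2 ⟨hu, hv.2.1⟩, ?_⟩
          calc μ (u ++ v) ≤ C * (μ u * μ v) := h.upper u v
            _ ≤ C * (1 * b ^ (-(n * d + a' * rateScale χ n))) := by
              gcongr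
              · exact h.nonneg v
              · exact h.le_one u
              · exact hv.2.2
            _ = b ^ (Real.logb b C + -(n * d + a' * rateScale χ n)) := by
              rw [one_mul, Real.rpow_add hb0, Real.rpow_logb hb0 hb.ne' hC]
            _ ≤ _ := by
              refine Real.rpow_le_rpow_of_exponent_le hb.le ?_
              push_cast at hn2 ⊢
              linarith

end Words

/-! ### Geometry of the cubes -/

section Cubes

variable {ℓ D n : ℕ}

theorem eq_cubeAt_of_mem (hℓ : 0 < ℓ) {Q : Set (EuclideanSpace ℝ (Fin D))}
    (hQ : Q ∈ adicCubes ℓ D n) {x : EuclideanSpace ℝ (Fin D)} (hx : x ∈ Q) :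
    Q = cubeAt ℓ D n x := by
  obtain ⟨k, -, rfl⟩ := hQ
  rw [cubeAt]
  congr 1
  funext i
  have hp : (0 : ℝ) < (ℓ : ℝ) ^ n := by positivity
  obtain ⟨h1, h2⟩ := hx i
  rw [div_le_iff₀ hp] at h1
  rw [lt_div_iff₀ hp] at h2
  have h0 : (0 : ℝ) ≤ k i := Nat.cast_nonneg _
  rw [mul_comm] at h1 h2
  exact ((Nat.floor_eq_iff (h0.trans h1)).2 ⟨h1, h2⟩).symm

theorem mem_cubeAt (hℓ : 0 < ℓ) {x : EuclideanSpace ℝ (Fin D)} (hx : x ∈ unitCube D) :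
    x ∈ cubeAt ℓ D n x := by
  intro i
  have hp : (0 : ℝ) < (ℓ : ℝ) ^ n := by positivity
  have h0 : 0 ≤ (ℓ : ℝ) ^ n * x i := mul_nonneg hp.le (hx i).1
  refine ⟨?_, ?_⟩
  · rw [div_le_iff₀ hp, mul_comm (x i)]
    exact Nat.floor_le h0
  · rw [lt_div_iff₀ hp, mul_comm (x i)]
    exact Nat.lt_floor_add_one _

theorem cubeAt_mem_adicCubes (hℓ : 0 < ℓ) {x : EuclideanSpace ℝ (Fin D)} (hx : x ∈ unitCube D) :
    cubeAt ℓ D n x ∈ adicCubes ℓ D n := by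
  refine ⟨_, fun i => ?_, rfl⟩
  have hp : (0 : ℝ) < (ℓ : ℝ) ^ n := by positivity
  rw [Nat.floor_lt (mul_nonneg hp.le (hx i).1)]
  push_cast
  exact mul_lt_of_lt_one_right hp (hx i).2

theorem subset_unitCube (hℓ : 0 < ℓ) {Q : Set (EuclideanSpace ℝ (Fin D))}
    (hQ : Q ∈ adicCubes ℓ D n) : Q ⊆ unitCube D := by
  obtain ⟨k, hk, rfl⟩ := hQ
  intro x hx i
  have hp : (0 : ℝ) < (ℓ : ℝ) ^ n := by positivity
  refine ⟨le_trans (by positivity) (hx i).1, (hx i).2.trans_le ?_⟩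
  rw [div_le_one hp]
  exact_mod_cast hk i

theorem measurableSet_adicCube (k : Fin D → ℕ) : MeasurableSet (adicCube ℓ D n k) := by
  have : adicCube ℓ D n k = ⋂ i, (fun x : EuclideanSpace ℝ (Fin D) => x i) ⁻¹'
      Ico ((k i : ℝ) / (ℓ : ℝ) ^ n) (((k i : ℝ) + 1) / (ℓ : ℝ) ^ n) := by
    ext x
    simp [adicCube]
  rw [this]
  refine MeasurableSet.iInter fun i => measurableSet_Ico.preimage ?_
  fun_prop

theorem measurableSet_unitCube : MeasurableSet (unitCube D) := by
  have : unitCube D = ⋂ i, (fun x : EuclideanSpace ℝ (Fin D) => x i) ⁻¹' Ico (0 : ℝ) 1 := by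
    ext x
    simp [unitCube]
  rw [this]
  refine MeasurableSet.iInter fun i => measurableSet_Ico.preimage ?_
  fun_prop

end Cubes

/-! ### Codings -/

namespace IsAdicCoding

variable {ℓ D : ℕ} {I : List (Fin (ℓ ^ D)) → Set (EuclideanSpace ℝ (Fin D))}
  (hI : IsAdicCoding ℓ D I)

include hI

theorem mem_adicCubes (w : List (Fin (ℓ ^ D))) : I w ∈ adicCubes ℓ D w.length :=
  (hI.bijOn w.length).mapsTo rfl

theorem measurableSet (w : List (Fin (ℓ ^ D))) : MeasurableSet (I w) := by
  obtain ⟨k, -, hk⟩ := hI.mem_adicCubes w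
  rw [hk]
  exact measurableSet_adicCube k

theorem subset_unitCube (hℓ : 0 < ℓ) (w : List (Fin (ℓ ^ D))) : I w ⊆ unitCube D :=
  QuasiBernoulli.subset_unitCube hℓ (hI.mem_adicCubes w)

theorem eq_cubeAt (hℓ : 0 < ℓ) {w : List (Fin (ℓ ^ D))} {x : EuclideanSpace ℝ (Fin D)}
    (hx : x ∈ I w) : I w = cubeAt ℓ D w.length x :=
  eq_cubeAt_of_mem hℓ (hI.mem_adicCubes w) hx

theorem exists_mem (hℓ : 0 < ℓ) {x : EuclideanSpace ℝ (Fin D)} (hx : x ∈ unitCube D) (n : ℕ) :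
    ∃ w, w.length = n ∧ x ∈ I w := by
  obtain ⟨w, hw, hwx⟩ := (hI.bijOn n).surjOn (cubeAt_mem_adicCubes (n := n) hℓ hx)
  exact ⟨w, hw, hwx ▸ mem_cubeAt hℓ hx⟩

theorem eq_of_mem (hℓ : 0 < ℓ) {u v : List (Fin (ℓ ^ D))} (huv : u.length = v.length)
    {x : EuclideanSpace ℝ (Fin D)} (hu : x ∈ I u) (hv : x ∈ I v) : u = v := by
  refine (hI.bijOn v.length).injOn huv rfl ?_
  rw [hI.eq_cubeAt hℓ hu, hI.eq_cubeAt hℓ hv, huv]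

theorem append_subset (u v : List (Fin (ℓ ^ D))) : I (u ++ v) ⊆ I u := by
  induction v using List.reverseRecOn with
  | nil => simp
  | append_singleton v ε ih =>
    rw [← List.append_assoc]
    exact (hI.nested _ _).trans ih

theorem pairwiseDisjoint (hℓ : 0 < ℓ) (n : ℕ) :
    (words (Fin (ℓ ^ D)) n : Set (List (Fin (ℓ ^ D)))).PairwiseDisjoint I := by
  intro u hu v hv huv
  rw [coe_words] at hu hv
  refine Set.disjoint_left.2 fun x hxu hxv => huv ?_
  exact hI.eq_of_mem hℓ (hu.trans hv.symm) hxu hxv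

theorem tauN_eq (m : Measure (EuclideanSpace ℝ (Fin D))) (n : ℕ) (q : ℝ) :
    tauN ℓ m n q =
      1 / (n * Real.log ℓ) * Real.log (partitionSum (fun w => m.real (I w)) n q) := by
  have hbij : BijOn I ((words (Fin (ℓ ^ D)) n).filter (fun w => 0 < m.real (I w)) :
      Finset (List (Fin (ℓ ^ D)))) {Q ∈ adicCubes ℓ D n | 0 < m.real Q} := by
    have hb := hI.bijOn n
    refine ⟨fun w hw => ?_, fun u hu v hv => ?_, fun Q hQ => ?_⟩
    · simp only [Finset.coe_filter, mem_words, mem_ofPred_eq] at hw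
      exact ⟨hb.mapsTo hw.1, hw.2⟩
    · simp only [Finset.coe_filter, mem_words, mem_ofPred_eq] at hu hv
      exact hb.injOn hu.1 hv.1
    · obtain ⟨w, hw, rfl⟩ := hb.surjOn hQ.1
      refine ⟨w, ?_, rfl⟩
      simp only [Finset.coe_filter, mem_words, mem_ofPred_eq]
      exact ⟨hw, hQ.2⟩
  rw [tauN, partitionSum, ← finsum_mem_coe_finset]
  rw [finsum_mem_eq_of_bijOn I hbij (g := fun Q => m.real Q ^ q) (fun w _ => rfl)]

variable {m : Measure (EuclideanSpace ℝ (Fin D))} [IsProbabilityMeasure m]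

theorem measureReal_eq_sum (hℓ : 0 < ℓ) (hm : m (unitCube D) = 1) (n : ℕ)
    {E : Set (EuclideanSpace ℝ (Fin D))} (hE : MeasurableSet E) :
    m.real E = ∑ w ∈ words (Fin (ℓ ^ D)) n, m.real (E ∩ I w) := by
  rw [← measureReal_biUnion_finset]
  · refine measureReal_congr ?_
    have hae : ∀ᵐ x ∂m, x ∈ unitCube D := by
      exact (mem_ae_iff_prob_eq_one measurableSet_unitCube).2 hm
    filter_upwards [hae] with x hx
    refine propext ⟨fun hxE => ?_, fun hxE => ?_⟩
    · obtain ⟨w, hw, hxw⟩ := hI.exists_mem hℓ hx n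
      exact mem_biUnion (show w ∈ (words (Fin (ℓ ^ D)) n : Set _) by simpa using hw) ⟨hxE, hxw⟩
    · obtain ⟨w, -, hxw⟩ := mem_iUnion₂.1 hxE
      exact hxw.1
  · exact (hI.pairwiseDisjoint hℓ n).mono fun w => inter_subset_right
  · exact fun w _ => hE.inter (hI.measurableSet w)

theorem isQuasiBernoulliWeight (hℓ : 0 < ℓ) (hm : m (unitCube D) = 1) {C : ℝ} (hC : 1 ≤ C)
    (hqB : ∀ u v : List (Fin (ℓ ^ D)),
      1 / C * (m.real (I u) * m.real (I v)) ≤ m.real (I (u ++ v)) ∧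
        m.real (I (u ++ v)) ≤ C * (m.real (I u) * m.real (I v))) :
    IsQuasiBernoulliWeight (fun w => m.real (I w)) C where
  nonneg _ := measureReal_nonneg
  sum_eq_one n := by
    have := hI.measureReal_eq_sum hℓ hm n MeasurableSet.univ
    simpa using this.symm
  one_le := hC
  lower u v := (hqB u v).1
  upper u v := (hqB u v).2

/-- If every cube of generation `N` meets a family of cubes of some later generation in a definite
proportion, then almost every point lies in infinitely many cubes of the family. -/
theorem ae_frequently_mem (hℓ : 0 < ℓ) (hm : m (unitCube D) = 1)
    {P : List (Fin (ℓ ^ D)) → Prop} [DecidablePred P] {c : ℝ} (hc : 0 < c)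
    (hP : ∀ N : ℕ, ∃ n : ℕ, ∀ u ∈ words (Fin (ℓ ^ D)) N,
      c * m.real (I u) ≤ ∑ v ∈ words (Fin (ℓ ^ D)) n with P (u ++ v), m.real (I (u ++ v))) :
    ∀ᵐ x ∂m, ∃ᶠ n in atTop, ∃ w, w.length = n ∧ P w ∧ x ∈ I w := by
  set hit : ℕ → Set (EuclideanSpace ℝ (Fin D)) :=
    fun n => ⋃ w ∈ (words (Fin (ℓ ^ D)) n).filter P, I w with hhit
  have mem_hit : ∀ n x, x ∈ hit n ↔ ∃ w, w.length = n ∧ P w ∧ x ∈ I w := by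
    intro n x
    simp [hhit, and_assoc]
  have hit_meas : ∀ n, MeasurableSet (hit n) := fun n =>
    Finset.measurableSet_biUnion _ fun w _ => hI.measurableSet w
  simp only [frequently_atTop, ← mem_hit]
  refine ae_all_iff.2 fun N₀ => ?_
  set B : ℕ → Set (EuclideanSpace ℝ (Fin D)) :=
    fun N => ⋂ n ∈ Finset.Icc N₀ N, (hit n)ᶜ with hB
  have mem_B : ∀ N x, x ∈ B N ↔ ∀ n, N₀ ≤ n → n ≤ N → x ∉ hit n := by
    intro N x
    simp [hB]
  have B_meas : ∀ N, MeasurableSet (B N) := fun N =>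
    Finset.measurableSet_biInter _ fun n _ => (hit_meas n).compl
  have B_anti : Antitone B := fun N N' hN x hx => by
    rw [mem_B] at hx ⊢
    exact fun n h1 h2 => hx n h1 (h2.trans hN)
  -- Within the unit cube, B N is a union of cubes of generation N, since it only involves
  -- generations up to N. The hypothesis can thus be summed over the cubes contained in it.
  have adapted : ∀ N, ∀ u ∈ words (Fin (ℓ ^ D)) N, ∀ x ∈ I u, x ∈ B N → I u ⊆ B N := by
    intro N u hu x hxu hxB y hyu
    rw [mem_words] at hu
    rw [mem_B] at hxB ⊢
    intro n h1 h2 hy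
    refine hxB n h1 h2 ?_
    rw [mem_hit] at hy ⊢
    obtain ⟨w, hw, hPw, hyw⟩ := hy
    have hsub : I u ⊆ I (u.take n) := by
      conv_lhs => rw [← List.take_append_drop n u]
      exact hI.append_subset _ _
    have : w = u.take n := hI.eq_of_mem hℓ (by rw [hw, List.length_take, hu, min_eq_left h2]) hyw
      (hsub hyu)
    exact ⟨w, hw, hPw, this ▸ hsub hxu⟩
  have hit_lower : ∀ N, ∃ n, c * m.real (B N) ≤ m.real (B N ∩ hit (N + n)) := by
    intro N
    obtain ⟨n, hn⟩ := hP N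
    refine ⟨n, ?_⟩
    rw [hI.measureReal_eq_sum hℓ hm N (B_meas N),
      hI.measureReal_eq_sum hℓ hm N ((B_meas N).inter (hit_meas (N + n))), Finset.mul_sum]
    refine Finset.sum_le_sum fun u hu => ?_
    rcases (B N ∩ I u).eq_empty_or_nonempty with he | ⟨x, hxB, hxu⟩
    · rw [he]
      simp
    · have hsub := adapted N u hu x hxu hxB
      rw [inter_eq_right.2 hsub]
      refine (hn u hu).trans ?_
      rw [← measureReal_biUnion_finset]
      · refine measureReal_mono fun y hy => ?_
        obtain ⟨v, hv, hyv⟩ := mem_iUnion₂.1 hy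
        have hv' := Finset.mem_filter.1 hv
        have hyu := hI.append_subset u v hyv
        refine ⟨⟨hsub hyu, (mem_hit _ _).2 ⟨u ++ v, ?_, hv'.2, hyv⟩⟩, hyu⟩
        rw [List.length_append, mem_words.1 hu, mem_words.1 hv'.1]
      · intro v hv v' hv' hne
        simp only [Finset.coe_filter, mem_words, mem_ofPred_eq] at hv hv'
        refine hI.pairwiseDisjoint hℓ (u.length + n) ?_ ?_ fun h => hne (List.append_cancel_left h)
        · simp [hv.1]
        · simp [hv'.1]
      · exact fun v _ => hI.measurableSet _
  have key : ∀ N, N₀ ≤ N → m.real (⋂ N, B N) ≤ (1 - c) * m.real (B N) := by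
    intro N hN
    obtain ⟨n, hn⟩ := hit_lower N
    have h1 : m.real (⋂ N, B N) ≤ m.real (B N \ hit (N + n)) := by
      refine measureReal_mono fun x hx => ⟨mem_iInter.1 hx N, ?_⟩
      exact (mem_B _ _).1 (mem_iInter.1 hx (N + n)) _ (hN.trans (Nat.le_add_right _ _)) le_rfl
    have h2 := measureReal_inter_add_sdiff (μ := m) (s := B N) (hit_meas (N + n))
    linarith
  have lim : Tendsto (fun N => m.real (B N)) atTop (𝓝 (m.real (⋂ N, B N))) := by
    refine (ENNReal.tendsto_toReal (measure_ne_top _ _)).comp ?_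
    exact tendsto_measure_iInter_atTop (fun N => (B_meas N).nullMeasurableSet) B_anti
      ⟨0, measure_ne_top _ _⟩
  -- Letting N tend to infinity in `key` bounds the mass by 1 - c times itself, which forces it to
  -- vanish.
  have hle : m.real (⋂ N, B N) ≤ (1 - c) * m.real (⋂ N, B N) :=
    ge_of_tendsto (lim.const_mul (1 - c)) ((eventually_ge_atTop N₀).mono key)
  have hzero : m.real (⋂ N, B N) = 0 := by
    have := measureReal_nonneg (μ := m) (s := ⋂ N, B N)
    nlinarith
  have hzero' : m (⋂ N, B N) = 0 := (measureReal_eq_zero_iff).1 hzero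
  refine measure_mono_null (fun x hx => ?_) hzero'
  rw [mem_compl_iff, mem_ofPred_eq] at hx
  push Not at hx
  exact mem_iInter.2 fun N => (mem_B _ _).2 fun n h1 _ => hx n h1

end IsAdicCoding

/-! ### Comparison with packing measures -/

section Packing

variable {X : Type*} [MetricSpace X] [SecondCountableTopology X] [MeasurableSpace X]

/-- The Vitali covering lemma selects disjoint small balls, which form a packing, while their
fivefold enlargements cover E. -/
theorem measure_le_packingPre (m : Measure X) {φ : ℝ → ℝ≥0∞} {b : ℝ} (hb : 2 ≤ b) {E : Set X}
    (hE : ∀ x ∈ E, ∃ᶠ n : ℕ in atTop,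
      m (Metric.closedBall x (b ^ n)⁻¹) ≤ φ (b ^ (n + 2))⁻¹) :
    m E ≤ packingPre φ E := by
  have hb0 : 0 < b := by linarith
  refine le_iInf₂ fun δ hδ => ?_
  have hlim : ∀ᶠ n : ℕ in atTop, (b ^ (n + 2))⁻¹ / 2 ≤ δ := by
    have h1 : Tendsto (fun n : ℕ => b ^ n) atTop atTop :=
      tendsto_pow_atTop_atTop_of_one_lt (by linarith)
    have h2 : Tendsto (fun n : ℕ => (b ^ (n + 2))⁻¹ / 2) atTop (𝓝 (0 / 2)) :=
      ((tendsto_inv_atTop_zero.comp h1).comp (tendsto_add_atTop_nat 2)).div_const 2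
    rw [zero_div] at h2
    exact (h2.eventually_lt_const hδ).mono fun n hn => hn.le
  have hex : ∀ x ∈ E, ∃ n : ℕ, m (Metric.closedBall x (b ^ n)⁻¹) ≤ φ (b ^ (n + 2))⁻¹ ∧
      (b ^ (n + 2))⁻¹ / 2 ≤ δ := fun x hx => ((hE x hx).and_eventually hlim).exists
  choose! k hk using hex
  -- The gauge is then evaluated at 2r = b^(-(k+2)), and the two spare generations give 5r ≤ b^(-k),
  -- as b^2 ≥ 4.
  set r : X → ℝ := fun x => (b ^ (k x + 2))⁻¹ / 2 with hr
  have hr0 : ∀ x, 0 < r x := fun x => by positivity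
  obtain ⟨u, huE, hdisj, hcov⟩ := Vitali.exists_disjoint_subfamily_covering_enlargement_closedBall
    E (fun x => x) r δ (fun x hx => (hk x hx).2) 5 (by norm_num)
  have hcount : u.Countable := by
    refine hdisj.countable_of_nonempty_interior fun x _ => ⟨x, ?_⟩
    exact mem_interior_iff_mem_nhds.2 (Metric.closedBall_mem_nhds x (hr0 x))
  have hinj : InjOn (fun x => (x, r x)) u := fun x _ y _ hxy => congrArg Prod.fst hxy
  have hpack : IsPacking δ E ((fun x => (x, r x)) '' u) := by
    refine ⟨hcount.image _, ?_, ?_, ?_, ?_⟩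
    · rintro _ ⟨x, hx, rfl⟩
      exact huE hx
    · rintro _ ⟨x, hx, rfl⟩
      exact hr0 x
    · rintro _ ⟨x, hx, rfl⟩
      exact (hk x (huE hx)).2
    · rintro _ ⟨x, hx, rfl⟩ _ ⟨y, hy, rfl⟩ hne
      exact hdisj hx hy fun h => hne (by rw [h])
  refine le_iSup₂_of_le _ hpack ?_
  rw [tsum_image (fun p : X × ℝ => φ (2 * p.2)) hinj]
  calc m E ≤ m (⋃ x ∈ u, Metric.closedBall x (5 * r x)) := by
        refine measure_mono fun x hx => ?_
        obtain ⟨y, hy, hxy⟩ := hcov x hx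
        exact mem_biUnion hy (hxy (Metric.mem_closedBall_self (hr0 x).le))
    _ ≤ ∑' x : u, m (Metric.closedBall (x : X) (5 * r x)) := measure_biUnion_le m hcount _
    _ ≤ _ := by
        refine ENNReal.tsum_le_tsum fun x => ?_
        have h2 : 2 * r x = (b ^ (k x + 2))⁻¹ := by simp only [hr]; ring
        simp only [h2]
        refine le_trans (measure_mono (Metric.closedBall_subset_closedBall ?_))
          (hk x (huE x.2)).1
        simp only [hr]
        rw [pow_add, mul_inv]
        have h3 : (b ^ 2)⁻¹ ≤ 1 / 4 := by
          rw [← one_div]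
          exact one_div_le_one_div_of_le (by norm_num) (by nlinarith)
        have h4 : 0 < (b ^ k x)⁻¹ := by positivity
        nlinarith

theorem absolutelyContinuous_packingMeasure [BorelSpace X] {m : Measure X} {φ : ℝ → ℝ≥0∞} {b : ℝ}
    (hb : 2 ≤ b) (h : ∀ᵐ x ∂m, ∃ᶠ n : ℕ in atTop,
      m (Metric.closedBall x (b ^ n)⁻¹) ≤ φ (b ^ (n + 2))⁻¹) :
    m ≪ packingMeasure φ := by
  intro s hs
  have h0 : packingOuter φ s = 0 := by
    rw [packingMeasure] at hs
    exact le_antisymm ((le_toMeasure_apply _ _ s).trans hs.le) zero_le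
  refine le_antisymm (le_trans ?_ h0.le) zero_le
  rw [packingOuter, OuterMeasure.ofFunction_apply]
  refine le_iInf₂ fun U hU => ?_
  set G := {x | ∃ᶠ n : ℕ in atTop, m (Metric.closedBall x (b ^ n)⁻¹) ≤ φ (b ^ (n + 2))⁻¹} with hG
  calc m s ≤ m (⋃ i, U i ∩ G) := by
        refine measure_mono_ae ?_
        filter_upwards [h] with x hx hxs
        obtain ⟨i, hi⟩ := mem_iUnion.1 (hU hxs)
        exact mem_iUnion.2 ⟨i, hi, hx⟩
    _ ≤ ∑' i, m (U i ∩ G) := measure_iUnion_le _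
    _ ≤ ∑' i, packingPre φ (U i) := ENNReal.tsum_le_tsum fun i =>
        (measure_le_packingPre m hb fun x hx => hx.2).trans (packingPre_mono φ inter_subset_left)

end Packing

/-! ### Balls and cubes -/

section Neighbours

variable {ℓ D : ℕ}

/-- The integer vector `⌊ℓ^n x⌋`, coordinatewise. -/
def gridIndex (ℓ n : ℕ) (x : EuclideanSpace ℝ (Fin D)) : Fin D → ℤ := fun i => ⌊(ℓ : ℝ) ^ n * x i⌋

theorem measurable_gridIndex (n : ℕ) :
    Measurable (gridIndex ℓ n : EuclideanSpace ℝ (Fin D) → Fin D → ℤ) := by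
  refine measurable_pi_iff.2 fun i => Int.measurable_floor.comp ?_
  fun_prop

/-- The integer vectors with coordinates in `{-1, 0, 1}`. -/
def gridSteps (D : ℕ) : Finset (Fin D → ℤ) := Fintype.piFinset fun _ => Finset.Icc (-1) 1

theorem closedBall_subset_gridIndex_preimage (hℓ : 0 < ℓ) (n : ℕ)
    (x : EuclideanSpace ℝ (Fin D)) : Metric.closedBall x ((ℓ : ℝ) ^ n)⁻¹ ⊆
      ⋃ e ∈ gridSteps D, gridIndex ℓ n ⁻¹' {gridIndex ℓ n x + e} := by
  intro y hy
  have hp : (0 : ℝ) < (ℓ : ℝ) ^ n := by positivity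
  refine mem_biUnion (x := gridIndex ℓ n y - gridIndex ℓ n x) ?_ (by simp)
  simp only [gridSteps, Finset.mem_coe, Fintype.mem_piFinset, Finset.mem_Icc, Pi.sub_apply,
    gridIndex]
  intro i
  have h1 : |y i - x i| ≤ ((ℓ : ℝ) ^ n)⁻¹ := by
    have h2 := PiLp.norm_apply_le (y - x) i
    rw [← dist_eq_norm] at h2
    exact le_trans (by simpa using h2) (Metric.mem_closedBall.1 hy)
  have h2 : |(ℓ : ℝ) ^ n * y i - (ℓ : ℝ) ^ n * x i| ≤ 1 := by
    rw [← mul_sub, abs_mul, abs_of_pos hp]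
    calc _ ≤ (ℓ : ℝ) ^ n * ((ℓ : ℝ) ^ n)⁻¹ := mul_le_mul_of_nonneg_left h1 hp.le
      _ = 1 := mul_inv_cancel₀ hp.ne'
  rw [abs_le] at h2
  have ha := Int.floor_le ((ℓ : ℝ) ^ n * y i)
  have hb := Int.lt_floor_add_one ((ℓ : ℝ) ^ n * y i)
  have hc := Int.floor_le ((ℓ : ℝ) ^ n * x i)
  have hd := Int.lt_floor_add_one ((ℓ : ℝ) ^ n * x i)
  constructor
  · have : ((⌊(ℓ : ℝ) ^ n * x i⌋ : ℤ) : ℝ) < ((⌊(ℓ : ℝ) ^ n * y i⌋ + 2 : ℤ) : ℝ) := by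
      push_cast
      linarith
    have := Int.cast_lt.1 this
    omega
  · have : ((⌊(ℓ : ℝ) ^ n * y i⌋ : ℤ) : ℝ) < ((⌊(ℓ : ℝ) ^ n * x i⌋ + 2 : ℤ) : ℝ) := by
      push_cast
      linarith
    have := Int.cast_lt.1 this
    omega

theorem gridIndex_preimage_subset_cubeAt (hℓ : 0 < ℓ) (n : ℕ) {x : EuclideanSpace ℝ (Fin D)}
    (hx : x ∈ unitCube D) : gridIndex ℓ n ⁻¹' {gridIndex ℓ n x} ⊆ cubeAt ℓ D n x := by
  intro y hy i
  have hp : (0 : ℝ) < (ℓ : ℝ) ^ n := by positivity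
  have h0 : 0 ≤ (ℓ : ℝ) ^ n * x i := mul_nonneg hp.le (hx i).1
  have hi : ⌊(ℓ : ℝ) ^ n * y i⌋ = ⌊(ℓ : ℝ) ^ n * x i⌋ := congrFun hy i
  have hcast : ((⌊(ℓ : ℝ) ^ n * x i⌋₊ : ℕ) : ℝ) = ((⌊(ℓ : ℝ) ^ n * y i⌋ : ℤ) : ℝ) := by
    rw [hi]
    exact natCast_floor_eq_intCast_floor h0
  simp only [hcast]
  constructor
  · rw [div_le_iff₀ hp, mul_comm (y i)]
    exact Int.floor_le _
  · rw [lt_div_iff₀ hp, mul_comm (y i)]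
    exact Int.lt_floor_add_one _

/-- A ball of radius ℓ^(-n) meets only grid cells adjacent to that of its centre. A bad cell has at
most 1/t times the total mass of its neighbourhood; summing over all cells, each of the finitely
many translates contributes total mass 1. -/
theorem measure_heavy_ball_le (hℓ : 0 < ℓ) (m : Measure (EuclideanSpace ℝ (Fin D)))
    [IsProbabilityMeasure m] (n : ℕ) {t : ℝ≥0∞} (ht0 : t ≠ 0) (htop : t ≠ ∞) :
    m {x ∈ unitCube D | t * m (cubeAt ℓ D n x) < m (Metric.closedBall x ((ℓ : ℝ) ^ n)⁻¹)} ≤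
      t⁻¹ * (gridSteps D).card := by
  set ν : (Fin D → ℤ) → ℝ≥0∞ := fun k => m (gridIndex ℓ n ⁻¹' {k}) with hν
  have hsum : ∑' k, ν k = 1 := by
    rw [← measure_iUnion]
    · rw [← preimage_iUnion, iUnion_of_singleton, preimage_univ, measure_univ]
    · intro k k' hkk'
      exact Disjoint.preimage _ (disjoint_singleton.2 hkk')
    · exact fun k => measurable_gridIndex n (measurableSet_singleton k)
  set bad : Set (Fin D → ℤ) := {k | t * ν k ≤ ∑ e ∈ gridSteps D, ν (k + e)} with hbad
  have hsub : {x ∈ unitCube D | t * m (cubeAt ℓ D n x) < m (Metric.closedBall x ((ℓ : ℝ) ^ n)⁻¹)} ⊆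
      ⋃ k ∈ bad, gridIndex ℓ n ⁻¹' {k} := by
    rintro x ⟨hx, hlt⟩
    refine mem_biUnion (x := gridIndex ℓ n x) ?_ rfl
    calc t * ν (gridIndex ℓ n x) ≤ t * m (cubeAt ℓ D n x) := by
          gcongr
          exact measure_mono (gridIndex_preimage_subset_cubeAt hℓ n hx)
      _ ≤ m (Metric.closedBall x ((ℓ : ℝ) ^ n)⁻¹) := hlt.le
      _ ≤ m (⋃ e ∈ gridSteps D, gridIndex ℓ n ⁻¹' {gridIndex ℓ n x + e}) :=
          measure_mono (closedBall_subset_gridIndex_preimage hℓ n x)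
      _ ≤ _ := measure_biUnion_finset_le _ _
  calc _ ≤ m (⋃ k ∈ bad, gridIndex ℓ n ⁻¹' {k}) := measure_mono hsub
    _ ≤ ∑' k : bad, ν k := measure_biUnion_le m (Set.to_countable bad) _
    _ ≤ ∑' k : bad, t⁻¹ * ∑ e ∈ gridSteps D, ν (k + e) := by
        refine ENNReal.tsum_le_tsum fun k => ?_
        rw [← ENNReal.div_eq_inv_mul, ENNReal.le_div_iff_mul_le (Or.inl ht0) (Or.inl htop),
          mul_comm]
        exact k.2
    _ ≤ ∑' k, t⁻¹ * ∑ e ∈ gridSteps D, ν (k + e) :=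
        ENNReal.tsum_comp_le_tsum_of_injective Subtype.val_injective
          (fun k => t⁻¹ * ∑ e ∈ gridSteps D, ν (k + e))
    _ = t⁻¹ * ∑ e ∈ gridSteps D, ∑' k, ν (k + e) := by
        rw [ENNReal.tsum_mul_left, Summable.tsum_finsetSum fun e _ => ENNReal.summable]
    _ = t⁻¹ * (gridSteps D).card := by
        congr 1
        have hshift : ∀ e, ∑' k, ν (k + e) = 1 := fun e =>
          ((Equiv.addRight e).tsum_eq ν).trans hsum
        simp [hshift]

/-- For almost every `x`, balls have at most polynomially more mass than cubes. -/
theorem ae_eventually_measure_closedBall_le (hℓ : 0 < ℓ) (m : Measure (EuclideanSpace ℝ (Fin D)))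
    [IsProbabilityMeasure m] (hm : m (unitCube D) = 1) :
    ∀ᵐ x ∂m, ∀ᶠ n : ℕ in atTop, m.real (Metric.closedBall x ((ℓ : ℝ) ^ n)⁻¹) ≤
      ((n : ℝ) + 1) ^ 2 * m.real (cubeAt ℓ D n x) := by
  have hae : ∀ᵐ x ∂m, x ∈ unitCube D :=
    (mem_ae_iff_prob_eq_one measurableSet_unitCube).2 hm
  -- The threshold (n+1)^2 has summable inverses, as Borel–Cantelli requires.
  have hsum : ∑' n : ℕ, m {x ∈ unitCube D | ENNReal.ofReal (((n : ℝ) + 1) ^ 2) *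
      m (cubeAt ℓ D n x) < m (Metric.closedBall x ((ℓ : ℝ) ^ n)⁻¹)} ≠ ∞ := by
    refine ne_top_of_le_ne_top ?_ (ENNReal.tsum_le_tsum fun n : ℕ => measure_heavy_ball_le hℓ m n
      (t := ENNReal.ofReal (((n : ℝ) + 1) ^ 2)) ?_ ENNReal.ofReal_ne_top)
    · rw [ENNReal.tsum_mul_right]
      refine ENNReal.mul_ne_top ?_ (ENNReal.natCast_ne_top _)
      have hs : Summable fun n : ℕ => (((n : ℝ) + 1) ^ 2)⁻¹ := by
        have := (summable_nat_add_iff 1).2 (Real.summable_nat_pow_inv.2 one_lt_two)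
        simpa using this
      have := hs.tsum_ofReal_ne_top
      refine ne_of_eq_of_ne (tsum_congr fun n => ?_) this
      rw [ENNReal.ofReal_inv_of_pos (by positivity)]
    · rw [Ne, ENNReal.ofReal_eq_zero, not_le]
      positivity
  filter_upwards [hae, ae_eventually_notMem hsum] with x hx hev
  filter_upwards [hev] with n hn
  have h1 : m (Metric.closedBall x ((ℓ : ℝ) ^ n)⁻¹) ≤
      ENNReal.ofReal (((n : ℝ) + 1) ^ 2) * m (cubeAt ℓ D n x) := by
    by_contra! hlt
    exact hn ⟨hx, hlt⟩
  have h2 := ENNReal.toReal_mono (ENNReal.mul_ne_top ENNReal.ofReal_ne_top (measure_ne_top _ _)) h1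
  rwa [ENNReal.toReal_mul, ENNReal.toReal_ofReal (by positivity)] at h2

end Neighbours

/-! ### The spectrum of a quasi-Bernoulli measure -/

section Spectrum

variable {ℓ D : ℕ} {I : List (Fin (ℓ ^ D)) → Set (EuclideanSpace ℝ (Fin D))}
  {m : Measure (EuclideanSpace ℝ (Fin D))} {C : ℝ}

/-- Almost additivity turns the limsup defining τ into a limit, with an error in log ∑ m(I)^q that
is bounded in n. -/
theorem tendsto_tauN (hℓ : 2 ≤ ℓ) (hI : IsAdicCoding ℓ D I)
    (h : IsQuasiBernoulliWeight (fun w => m.real (I w)) C) (q : ℝ) :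
    Tendsto (fun n => tauN ℓ m n q) atTop (𝓝 (tau ℓ m q)) ∧
      ∀ n : ℕ, |Real.log (partitionSum (fun w => m.real (I w)) n q) -
        n * (tau ℓ m q * Real.log ℓ)| ≤ |q| * Real.log C := by
  obtain ⟨L, hL⟩ := h.exists_log_partitionSum_approx q
  have hlog : 0 < Real.log ℓ := Real.log_pos (by exact_mod_cast hℓ)
  have hlim : Tendsto (fun n => tauN ℓ m n q) atTop (𝓝 (L / Real.log ℓ)) := by
    have h0 : Tendsto (fun n : ℕ => |q| * Real.log C / Real.log ℓ / n) atTop (𝓝 0) :=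
      tendsto_const_div_atTop_nhds_zero_nat _
    rw [tendsto_iff_dist_tendsto_zero]
    refine squeeze_zero' (Eventually.of_forall fun _ => dist_nonneg) ?_ h0
    filter_upwards [eventually_gt_atTop 0] with n hn
    have hn' : (0 : ℝ) < n := by exact_mod_cast hn
    have heq : tauN ℓ m n q - L / Real.log ℓ =
        (Real.log (partitionSum (fun w => m.real (I w)) n q) - n * L) / (n * Real.log ℓ) := by
      rw [hI.tauN_eq]
      field_simp
    rw [Real.dist_eq, heq, abs_div, abs_of_pos (mul_pos hn' hlog), div_div, mul_comm (Real.log _)]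
    gcongr
    exact hL n
  have htau : tau ℓ m q = L / Real.log ℓ := hlim.limsup_eq
  refine ⟨htau ▸ hlim, fun n => ?_⟩
  rw [htau, div_mul_cancel₀ _ hlog.ne']
  exact hL n

theorem convexOn_tau (hℓ : 2 ≤ ℓ) (hI : IsAdicCoding ℓ D I)
    (h : IsQuasiBernoulliWeight (fun w => m.real (I w)) C) : ConvexOn ℝ univ (tau ℓ m) := by
  have hlog : 0 ≤ Real.log ℓ := Real.log_nonneg (by exact_mod_cast (by omega : 1 ≤ ℓ))
  refine ⟨convex_univ, fun x _ y _ a b ha hb hab => ?_⟩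
  have hx := (tendsto_tauN hℓ hI h x).1.const_mul a
  have hy := (tendsto_tauN hℓ hI h y).1.const_mul b
  refine le_of_tendsto_of_tendsto' (tendsto_tauN hℓ hI h _).1 (hx.add hy) fun n => ?_
  have := (h.convexOn_log_partitionSum n).2 (mem_univ x) (mem_univ y) ha hb hab
  simp only [hI.tauN_eq, smul_eq_mul] at this ⊢
  have h0 : 0 ≤ 1 / (n * Real.log ℓ) := by positivity
  have := mul_le_mul_of_nonneg_left this h0
  linarith

theorem tau_one (hℓ : 2 ≤ ℓ) (hI : IsAdicCoding ℓ D I)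
    (h : IsQuasiBernoulliWeight (fun w => m.real (I w)) C) : tau ℓ m 1 = 0 := by
  refine tendsto_nhds_unique (tendsto_tauN hℓ hI h 1).1 ?_
  simp only [hI.tauN_eq, h.partitionSum_one, Real.log_one, mul_zero]
  exact tendsto_const_nhds

theorem isDoublingRate_chi (hℓ : 2 ≤ ℓ) (hI : IsAdicCoding ℓ D I)
    (h : IsQuasiBernoulliWeight (fun w => m.real (I w)) C) {K : ℝ}
    (hχ : ∀ q ∈ Ioc (0 : ℝ) 1, 0 < chi ℓ m q ∧ chi ℓ m q ≤ K * chi ℓ m (q / 2)) :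
    IsDoublingRate (chi ℓ m) K where
  convex := by
    refine ⟨convex_univ, fun x _ y _ a b ha hb hab => ?_⟩
    have := (convexOn_tau hℓ hI h).2 (mem_univ (1 - x)) (mem_univ (1 - y)) ha hb hab
    simp only [chi, smul_eq_mul] at this ⊢
    have he : a * (1 - x) + b * (1 - y) = 1 - (a * x + b * y) := by linear_combination hab
    rw [he] at this
    linarith
  zero := by simp [chi, tau_one hℓ hI h]
  pos q hq := (hχ q hq).1
  doubling q hq := (hχ q hq).2

theorem partitionSum_bounds (hℓ : 2 ≤ ℓ) (hI : IsAdicCoding ℓ D I)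
    (h : IsQuasiBernoulliWeight (fun w => m.real (I w)) C) (n : ℕ) {q : ℝ}
    (hq : q ∈ Icc (0 : ℝ) 1) :
    C⁻¹ * (ℓ : ℝ) ^ (n * (chi ℓ m q + q * dimension ℓ m)) ≤
        partitionSum (fun w => m.real (I w)) n (1 - q) ∧
      partitionSum (fun w => m.real (I w)) n (1 - q) ≤
        C * (ℓ : ℝ) ^ (n * (chi ℓ m q + q * dimension ℓ m)) := by
  have hC := h.pos
  have hℓ0 : (0 : ℝ) < ℓ := by exact_mod_cast (by omega : 0 < ℓ)
  have hZ := h.partitionSum_pos n (1 - q)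
  have hp : 0 < (ℓ : ℝ) ^ (n * (chi ℓ m q + q * dimension ℓ m)) := Real.rpow_pos_of_pos hℓ0 _
  have h1 := (tendsto_tauN hℓ hI h (1 - q)).2 n
  have h2 : |1 - q| * Real.log C ≤ Real.log C := by
    refine mul_le_of_le_one_left (Real.log_nonneg h.one_le) ?_
    rw [abs_le]
    constructor <;> linarith [hq.1, hq.2]
  have he : chi ℓ m q + q * dimension ℓ m = tau ℓ m (1 - q) := by
    rw [chi]
    ring
  have h3 := abs_le.1 (h1.trans h2)
  constructor
  · rw [← Real.log_le_log_iff (by positivity) hZ, Real.log_mul (by positivity) hp.ne',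
      Real.log_inv, Real.log_rpow hℓ0, he]
    linarith [h3.1]
  · rw [← Real.log_le_log_iff hZ (by positivity), Real.log_mul (by positivity) hp.ne',
      Real.log_rpow hℓ0, he]
    linarith [h3.2]

/-- The sum `S_n` telescopes to `-log_ℓ m(I_n(x))`. -/
theorem S_eq_neg_logb (hℓ : 0 < ℓ) (hI : IsAdicCoding ℓ D I)
    (h : IsQuasiBernoulliWeight (fun w => m.real (I w)) C) {w : List (Fin (ℓ ^ D))}
    {x : EuclideanSpace ℝ (Fin D)} (hx : x ∈ I w) (hw : 0 < m.real (I w)) :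
    S ℓ m w.length x = -Real.logb ℓ (m.real (I w)) := by
  have hcube : ∀ k ≤ w.length, cubeAt ℓ D k x = I (w.take k) := by
    intro k hk
    have hxk : x ∈ I (w.take k) := by
      refine hI.append_subset (w.take k) (w.drop k) ?_
      rwa [List.take_append_drop]
    rw [hI.eq_cubeAt hℓ hxk, List.length_take, min_eq_left hk]
  -- Every prefix cube has positive mass, so the logarithm of each quotient splits.
  have hpos : ∀ k, 0 < m.real (I (w.take k)) := fun k =>
    (h.append_pos_iff (u := w.take k) (v := w.drop k)).1 (by simpa using hw) |>.1
  have hnil : m.real (I []) = 1 := by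
    have h1 := h.sum_eq_one 0
    have h2 : words (Fin (ℓ ^ D)) 0 = {[]} := by
      ext w
      simp
    simpa [h2] using h1
  have key : ∀ k ≤ w.length, S ℓ m k x = -Real.logb ℓ (m.real (I (w.take k))) := by
    intro k
    induction k with
    | zero => simp [S, hnil]
    | succ k ih =>
      intro hk
      have ih' := ih (by omega)
      rw [S] at ih' ⊢
      rw [Finset.sum_Icc_succ_top (by omega), ih', X, Nat.add_sub_cancel, hcube _ hk,
        hcube k (by omega), Real.logb_div (hpos _).ne' (hpos _).ne']
      ring
  simpa using key w.length le_rfl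

theorem psi_inv_pow (hℓ : 2 ≤ ℓ) (a : ℝ) (n : ℕ) :
    psi ℓ m a ((ℓ : ℝ) ^ n)⁻¹ = (ℓ : ℝ) ^ (-(n * dimension ℓ m + a * theta ℓ m n)) := by
  have hb : (1 : ℝ) < ℓ := by exact_mod_cast hℓ
  have hb0 : (0 : ℝ) < ℓ := by linarith
  have hlog : Real.logb ℓ (1 / ((ℓ : ℝ) ^ n)⁻¹) = n := by
    rw [one_div, inv_inv, ← Real.rpow_natCast, Real.logb_rpow hb0 hb.ne']
  rw [psi, hlog, ← Real.rpow_natCast, ← Real.rpow_neg hb0.le, ← Real.rpow_mul hb0.le,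
    ← Real.rpow_add hb0]
  congr 1
  ring

/-! ### Almost sure fluctuations and absolute continuity. -/

variable [IsProbabilityMeasure m] {K : ℝ}

theorem ae_frequently_light (hℓ : 2 ≤ ℓ) (hm : m (unitCube D) = 1) (hI : IsAdicCoding ℓ D I)
    (h : IsQuasiBernoulliWeight (fun w => m.real (I w)) C) (hχ : IsDoublingRate (chi ℓ m) K)
    {a : ℝ} (ha0 : 0 < a) (ha1 : a < 1) :
    ∀ᵐ x ∂m, ∃ᶠ n : ℕ in atTop, ∃ w, w.length = n ∧ x ∈ I w ∧ 0 < m.real (I w) ∧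
      m.real (I w) ≤ (ℓ : ℝ) ^ (-(n * dimension ℓ m + a * theta ℓ m n)) := by
  classical
  have hb : (1 : ℝ) < ℓ := by exact_mod_cast hℓ
  obtain ⟨c, hc, hP⟩ := h.exists_le_sum_append_light hχ hb
    (fun n q hq => partitionSum_bounds hℓ hI h n hq) ha0 ha1
  have key := hI.ae_frequently_mem (by omega) hm (c := c)
    (P := fun w => IsLight (fun w => m.real (I w)) ℓ (dimension ℓ m) w.length
      (a * rateScale (chi ℓ m) w.length) w) hc (by
    intro N
    obtain ⟨n, hn⟩ := hP N
    refine ⟨n, fun u hu => (hn u hu).trans (le_of_eq ?_)⟩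
    refine Finset.sum_congr (Finset.filter_congr fun v hv => ?_) fun _ _ => rfl
    rw [List.length_append, mem_words.1 hu, mem_words.1 hv])
  filter_upwards [key] with x hx
  refine hx.mono ?_
  rintro n ⟨w, rfl, hw, hxw⟩
  exact ⟨w, rfl, hxw, hw.1, hw.2⟩

theorem ae_one_le_limsup (hℓ : 2 ≤ ℓ) (hm : m (unitCube D) = 1) (hI : IsAdicCoding ℓ D I)
    (h : IsQuasiBernoulliWeight (fun w => m.real (I w)) C) (hχ : IsDoublingRate (chi ℓ m) K) :
    ∀ᵐ x ∂m, (1 : EReal) ≤ limsup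
      (fun n : ℕ => (((S ℓ m n x - n * dimension ℓ m) / theta ℓ m n : ℝ) : EReal)) atTop := by
  have hb : (1 : ℝ) < ℓ := by exact_mod_cast hℓ
  -- Countably many values of a increase to 1; the shift by 2 keeps them in (0, 1).
  have hseq : ∀ k : ℕ, ∀ᵐ x ∂m, ((1 - 1 / ((k : ℝ) + 2) : ℝ) : EReal) ≤ limsup
      (fun n : ℕ => (((S ℓ m n x - n * dimension ℓ m) / theta ℓ m n : ℝ) : EReal)) atTop := by
    intro k
    have hk : 1 / ((k : ℝ) + 2) < 1 := by
      rw [div_lt_one (by positivity)]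
      have : (0 : ℝ) ≤ k := Nat.cast_nonneg k
      linarith
    have hk0 : 0 < 1 / ((k : ℝ) + 2) := by positivity
    filter_upwards [ae_frequently_light hℓ hm hI h hχ (a := 1 - 1 / ((k : ℝ) + 2))
      (by linarith) (by linarith)] with x hx
    refine le_limsup_of_frequently_le' ?_
    have hθ : ∀ᶠ n : ℕ in atTop, 0 < theta ℓ m n := hχ.tendsto_rateScale.eventually_gt_atTop 0
    refine (hx.and_eventually hθ).mono ?_
    rintro n ⟨⟨w, rfl, hxw, hw0, hw⟩, hn⟩
    rw [EReal.coe_le_coe_iff, S_eq_neg_logb (by omega) hI h hxw hw0, le_div_iff₀ hn]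
    have := (Real.logb_le_iff_le_rpow hb hw0).2 hw
    linarith
  filter_upwards [ae_all_iff.2 hseq] with x hx
  have hlim : Tendsto (fun k : ℕ => ((1 - 1 / ((k : ℝ) + 2) : ℝ) : EReal)) atTop
      (𝓝 ((1 - 0 : ℝ) : EReal)) := by
    refine (continuous_coe_real_ereal.tendsto _).comp (tendsto_const_nhds.sub ?_)
    refine tendsto_const_nhds.div_atTop ?_
    exact tendsto_atTop_add_const_right _ _ tendsto_natCast_atTop_atTop
  rw [sub_zero, EReal.coe_one] at hlim
  exact le_of_tendsto' hlim hx

/-- Since n ≤ Bθ(n)^k, a polynomial in n is bounded by one in θ(n), which an exponential of θ(n)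
dominates. -/
theorem IsDoublingRate.eventually_sq_le_rpow {χ : ℝ → ℝ} (hχ : IsDoublingRate χ K) {b η : ℝ}
    (hb : 1 < b) (hη : 0 < η) :
    ∀ᶠ n : ℕ in atTop, ((n : ℝ) + 1) ^ 2 ≤ b ^ (η * rateScale χ n) := by
  obtain ⟨B, k, hB, hk⟩ := hχ.exists_le_mul_rateScale_pow
  have hlog := Real.log_pos hb
  have h1 := (tendsto_exp_mul_div_rpow_atTop ((2 * k : ℕ) : ℝ) (Real.log b * η) (by positivity)).comp
    hχ.tendsto_rateScale
  have h2 : ∀ᶠ n : ℕ in atTop, 1 / χ 1 ≤ (n : ℝ) :=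
    tendsto_natCast_atTop_atTop.eventually_ge_atTop _
  filter_upwards [h1.eventually_ge_atTop (4 * B ^ 2), h2, eventually_ge_atTop 1] with n hn hn2 hn1
  have hS := hχ.rateScale_pos hn2
  have hn1' : (1 : ℝ) ≤ n := by exact_mod_cast hn1
  simp only [Function.comp_apply] at hn
  rw [Real.rpow_natCast, le_div_iff₀ (by positivity)] at hn
  rw [Real.rpow_def_of_pos (by linarith), ← mul_assoc]
  refine le_trans ?_ hn
  calc ((n : ℝ) + 1) ^ 2 ≤ (2 * (B * rateScale χ n ^ k)) ^ 2 := by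
        refine pow_le_pow_left₀ (by positivity) ?_ 2
        linarith [hk n hn2]
    _ = _ := by ring

/-- Almost every `x` is the centre of arbitrarily small balls of mass at most `ψ_a`. -/
theorem ae_frequently_closedBall_le (hℓ : 2 ≤ ℓ) (hm : m (unitCube D) = 1)
    (hI : IsAdicCoding ℓ D I) (h : IsQuasiBernoulliWeight (fun w => m.real (I w)) C)
    (hχ : IsDoublingRate (chi ℓ m) K) {a : ℝ} (ha0 : 0 < a) (ha1 : a < 1) :
    ∀ᵐ x ∂m, ∃ᶠ n : ℕ in atTop, m.real (Metric.closedBall x ((ℓ : ℝ) ^ n)⁻¹) ≤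
      (ℓ : ℝ) ^ (-(((n + 2 : ℕ) : ℝ) * dimension ℓ m + a * theta ℓ m ((n + 2 : ℕ) : ℝ))) := by
  have hb : (1 : ℝ) < ℓ := by exact_mod_cast hℓ
  have hb0 : (0 : ℝ) < ℓ := by linarith
  -- The margin a₂ - a₁ absorbs the factor (n+1)^2 between ball and cube; a₁ - a absorbs the passage
  -- from n to n + 2.
  obtain ⟨a₂, haa₂, ha₂1⟩ := exists_between ha1
  obtain ⟨a₁, haa₁, ha₁₂⟩ := exists_between haa₂
  filter_upwards [ae_frequently_light hℓ hm hI h hχ (ha0.trans haa₂) ha₂1,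
    ae_eventually_measure_closedBall_le (ℓ := ℓ) (by omega) m hm] with x hx hball
  have hsq := hχ.eventually_sq_le_rpow hb (sub_pos.2 ha₁₂)
  have hsc := hχ.eventually_scale_add_le ha0 haa₁ 2 (2 * dimension ℓ m)
  refine (hx.and_eventually (hball.and (hsq.and hsc))).mono ?_
  rintro n ⟨⟨w, rfl, hxw, hw0, hw⟩, hn1, hn2, hn3⟩
  rw [← hI.eq_cubeAt (by omega) hxw] at hn1
  refine hn1.trans ((mul_le_mul hn2 hw hw0.le (by positivity)).trans ?_)
  rw [← Real.rpow_add hb0]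
  refine Real.rpow_le_rpow_of_exponent_le hb.le ?_
  change _ + -(_ + a₂ * rateScale (chi ℓ m) _) ≤ -(_ + a * rateScale (chi ℓ m) _)
  rw [add_comm 2 w.length] at hn3
  push_cast at hn3 ⊢
  linarith

theorem absolutelyContinuous_of_gauge (hℓ : 2 ≤ ℓ) (hm : m (unitCube D) = 1)
    (hI : IsAdicCoding ℓ D I) (h : IsQuasiBernoulliWeight (fun w => m.real (I w)) C)
    (hχ : IsDoublingRate (chi ℓ m) K) {a : ℝ} (ha0 : 0 < a) (ha1 : a < 1) {φ : ℝ → ℝ}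
    (hφ : ∀ᶠ n : ℕ in atTop,
      (ℓ : ℝ) ^ (-(n * dimension ℓ m + a * theta ℓ m n)) ≤ φ ((ℓ : ℝ) ^ n)⁻¹) :
    m ≪ packingMeasure fun t => ENNReal.ofReal (φ t) := by
  refine absolutelyContinuous_packingMeasure (b := ℓ) (by exact_mod_cast hℓ) ?_
  filter_upwards [ae_frequently_closedBall_le hℓ hm hI h hχ ha0 ha1] with x hx
  refine (hx.and_eventually ((tendsto_add_atTop_nat 2).eventually hφ)).mono ?_
  rintro n ⟨hn1, hn2⟩
  rw [← ofReal_measureReal]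
  exact ENNReal.ofReal_le_ofReal (hn1.trans hn2)

end Spectrum

end QuasiBernoulli

end

open QuasiBernoulli in
theorem mainTheorem10 (ℓ D : ℕ) (hℓ : 2 ≤ ℓ) (hD : 1 ≤ D)
    (m : MeasureTheory.Measure (EuclideanSpace ℝ (Fin D)))
    [MeasureTheory.IsProbabilityMeasure m] (hm : m (unitCube D) = 1)
    (I : List (Fin (ℓ ^ D)) → Set (EuclideanSpace ℝ (Fin D))) (hI : IsAdicCoding ℓ D I)
    (hqB : IsQuasiBernoulli I m)
    (hχ : ∃ C : ℝ, 0 < C ∧ ∀ q ∈ Set.Ioc (0 : ℝ) 1,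
      0 < chi ℓ m q ∧ chi ℓ m q ≤ C * chi ℓ m (q / 2)) :
    Set.BijOn (chi ℓ m) (Set.Icc 0 1) (Set.Icc 0 (chi ℓ m 1)) ∧
    (∀ᵐ x ∂m, (1 : EReal) ≤ Filter.limsup
      (fun n : ℕ => (((S ℓ m n x - n * dimension ℓ m) / theta ℓ m n : ℝ) : EReal))
      Filter.atTop) ∧
    (∀ a : ℝ, 0 < a → a < 1 →
      m.AbsolutelyContinuous (packingMeasure fun t => ENNReal.ofReal (psi ℓ m a t))) ∧
    m.AbsolutelyContinuous (packingMeasure fun t => ENNReal.ofReal (t ^ dimension ℓ m)) := by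
  obtain ⟨C, hC, hqB⟩ := hqB
  obtain ⟨K, -, hχ⟩ := hχ
  have h := hI.isQuasiBernoulliWeight (by omega) hm hC hqB
  have hrate := isDoublingRate_chi hℓ hI h hχ
  refine ⟨hrate.bijOn, ae_one_le_limsup hℓ hm hI h hrate, fun a ha0 ha1 => ?_, ?_⟩
  · exact absolutelyContinuous_of_gauge hℓ hm hI h hrate ha0 ha1
      (Filter.Eventually.of_forall fun n => (psi_inv_pow hℓ a n).ge)
  -- Any a in (0, 1) would do: once θ(n) > 0, the gauge t^d dominates ψ_a at t = ℓ^(-n).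
  · refine absolutelyContinuous_of_gauge hℓ hm hI h hrate (a := 1 / 2) (by norm_num) (by norm_num) ?_
    have hθ : ∀ᶠ n : ℕ in Filter.atTop, 0 < theta ℓ m n :=
      hrate.tendsto_rateScale.eventually_gt_atTop 0
    filter_upwards [hθ] with n hn
    have hb : (1 : ℝ) ≤ ℓ := by exact_mod_cast (by omega : 1 ≤ ℓ)
    have hb0 : (0 : ℝ) ≤ ℓ := by linarith
    rw [← Real.rpow_natCast, ← Real.rpow_neg hb0, ← Real.rpow_mul hb0]
    refine Real.rpow_le_rpow_of_exponent_le hb ?_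
    linarith
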